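/- Let $N\ge 1$ and let $\Omega\subset\mathbb{R}^N$ be a bounded domain (nonempty, open, connected), with Lebesgue measure $|\Omega|$. Let $\omega_{N-1}$ be the surface measure of the unit sphere in $\mathbb{R}^N$ ($\omega_0=2$), and put $$c_N=\pi^{-N/2}\Gamma(N/2),\qquad \rho_N=2\ln 2+\psi(N/2)-\gamma,\qquad d_N=\frac{2\omega_{N-1}}{N^2(2\pi)^N},$$ where $\psi=\Gamma'/\Gamma$ and $\gamma$ is the Euler–Mascheroni constant. Let $\mathbb{H}(\Omega)$ be the space of measurable $u:\mathbb{R}^N\to\mathbb{R}$ with $u=0$ on $\mathbb{R}^N\setminus\Omega$ and $\iint_{|x-y|\le1}\frac{(u(x)-u(y))^2}{|x-y|^N}\,dx\,dy<\infty$, and for $u,w\in\mathbb{H}(\Omega)$ let $$\mathcal{E}_L(u,w)=\frac{c_N}{2}\iint_{|x-y|\le1}\frac{(u(x)-u(y))(w(x)-w(y))}{|x-y|^N}\,dx\,dy-c_N\iint_{|x-y|\ge1}\frac{u(x)w(y)}{|x-y|^N}\,dx\,dy+\rho_N\int_{\mathbb{R}^N}uw\,dx$$ be the quadratic form of the logarithmic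 Laplacian $L_\Delta$ (the operator with Fourier symbol $2\ln|\xi|$). A real number $\lambda$ is an eigenvalue of the Dirichlet problem $L_\Delta u=\lambda u$ in $\Omega$, $u=0$ in $\mathbb{R}^N\setminus\Omega$, if there is $u\in\mathbb{H}(\Omega)$, not a.e. zero (an eigenfunction), with $\mathcal{E}_L(u,\phi)=\lambda\int_\Omega u\phi\,dx$ for all $\phi\in\mathbb{H}(\Omega)$. Let $\lambda_1(\Omega)\le\lambda_2(\Omega)\le\cdots$ be these eigenvalues in nondecreasing order, counted with multiplicity; that is, $\lambda_k(\Omega)$ is the infimum (in the extended reals) of all real $t$ for which there are $k$ eigenfunctions, orthonormal in $L^2(\Omega)$, with eigenvalues at most $t$. Then for every integer $k\ge1$: (i) $$\sum_{i=1}^k\lambda_i(\Omega)\ \ge\ -d_N|\Omega|;$$ (ii) if $k>\frac{eNd_N}{2}|\Omega|$, then $$\sum_{i=1}^k\lambda_i(\Omega)>0;$$ (iii) if $k\ge\frac{e^{e+1}Nd_N}{2}|\Omega|$, then $$\sum_{i=1}^k\lambda_i(\Omega)\ \ge\ \frac{2k}{N}\left(\ln k+\ln\Big(\frac{2}{eNd_N|\Omega|}\Big)-\ln\ln\Big(\frac{2k}{eNd_N|\Omega|}\Big)\right).$$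 -/

import Mathlib

open MeasureTheory

namespace LogLaplacian

noncomputable section

/-- The surface measure of the unit sphere of `ℝ^N` (equal to `2` for `N = 1`). -/
def sphereArea (N : ℕ) : ℝ :=
  (volume : Measure (EuclideanSpace ℝ (Fin N))).toSphere.real Set.univ

/-- `c_N = π^{-N/2} Γ(N/2)`. -/
def cConst (N : ℕ) : ℝ :=
  Real.pi ^ (-((N : ℝ) / 2)) * Real.Gamma ((N : ℝ) / 2)

/-- `ρ_N = 2 ln 2 + ψ(N/2) - γ`, where `ψ = Γ'/Γ` is the digamma function and `γ` is the
Euler-Mascheroni constant. -/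
def rhoConst (N : ℕ) : ℝ :=
  2 * Real.log 2 + logDeriv Real.Gamma ((N : ℝ) / 2) - Real.eulerMascheroniConstant

/-- `d_N = 2 ω_{N-1} / (N² (2π)^N)`. -/
def dConst (N : ℕ) : ℝ :=
  2 * sphereArea N / ((N : ℝ) ^ 2 * (2 * Real.pi) ^ N)

/-- The pairs of points at distance at most one. -/
def nearPairs (N : ℕ) : Set (EuclideanSpace ℝ (Fin N) × EuclideanSpace ℝ (Fin N)) :=
  {p | dist p.1 p.2 ≤ 1}

/-- The pairs of points at distance at least one. -/
def farPairs (N : ℕ) : Set (EuclideanSpace ℝ (Fin N) × EuclideanSpace ℝ (Fin N)) :=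
  {p | 1 ≤ dist p.1 p.2}

/-- Membership in the form domain `ℍ(Ω)`: measurable functions on `ℝ^N` which vanish outside
`Ω` and for which `(u(x) - u(y))² / |x - y|^N` is integrable over `|x - y| ≤ 1`. -/
structure MemH {N : ℕ} (Ω : Set (EuclideanSpace ℝ (Fin N)))
    (u : EuclideanSpace ℝ (Fin N) → ℝ) : Prop where
  measurable : Measurable u
  eq_zero : ∀ x, x ∉ Ω → u x = 0
  integrableOn : IntegrableOn
    (fun p : EuclideanSpace ℝ (Fin N) × EuclideanSpace ℝ (Fin N) =>
      (u p.1 - u p.2) ^ 2 / dist p.1 p.2 ^ N) (nearPairs N) volume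

/-- The inner product `ℰ(u, w)` of `ℍ(Ω)`. -/
def energy {N : ℕ} (u w : EuclideanSpace ℝ (Fin N) → ℝ) : ℝ :=
  cConst N / 2 * ∫ p in nearPairs N,
    (u p.1 - u p.2) * (w p.1 - w p.2) / dist p.1 p.2 ^ N

/-- The quadratic form `ℰ_L(u, w)` associated with the logarithmic Laplacian. -/
def formL {N : ℕ} (u w : EuclideanSpace ℝ (Fin N) → ℝ) : ℝ :=
  energy u w
    - cConst N * (∫ p in farPairs N, u p.1 * w p.2 / dist p.1 p.2 ^ N)
    + rhoConst N * ∫ x, u x * w x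

/-- `u` is a (nontrivial) eigenfunction of the Dirichlet problem `L_Δ u = lam u` in `Ω`,
`u = 0` outside `Ω`, in the weak sense. -/
structure IsEigenfunction {N : ℕ} (Ω : Set (EuclideanSpace ℝ (Fin N))) (lam : ℝ)
    (u : EuclideanSpace ℝ (Fin N) → ℝ) : Prop where
  memH : MemH Ω u
  ne_zero : ¬ (∀ᵐ x, u x = 0)
  weak_eq : ∀ φ : EuclideanSpace ℝ (Fin N) → ℝ, MemH Ω φ →
    formL u φ = lam * ∫ x in Ω, u x * φ x

/-- There are at least `k` eigenvalues not exceeding `t`, counted with multiplicity: there are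
`k` eigenfunctions, orthonormal in `L²(Ω)`, whose eigenvalues are at most `t`. -/
def HasEigenvaluesUpTo {N : ℕ} (Ω : Set (EuclideanSpace ℝ (Fin N))) (k : ℕ) (t : ℝ) : Prop :=
  ∃ (μ : Fin k → ℝ) (φ : Fin k → EuclideanSpace ℝ (Fin N) → ℝ),
    (∀ i, IsEigenfunction Ω (μ i) (φ i) ∧ μ i ≤ t) ∧
    ∀ i j, ∫ x in Ω, φ i x * φ j x = if i = j then 1 else 0

/-- The `k`-th eigenvalue `λ_k(Ω)` (`k ≥ 1`), in nondecreasing order and counted with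
multiplicity: the least `t` such that at least `k` eigenvalues do not exceed `t`. The infimum is
taken in the extended reals so that no junk value is involved. -/
def eigenvalue {N : ℕ} (Ω : Set (EuclideanSpace ℝ (Fin N))) (k : ℕ) : EReal :=
  sInf ((fun t : ℝ => (t : EReal)) '' {t : ℝ | HasEigenvaluesUpTo Ω k t})

end

end LogLaplacian

namespace LogLaplacian

open Set Filter Topology Real

/-! This is a Berezin–Li–Yau argument in which the symbol `2 ln|ξ|` is reached as a limit of the
symbols `(1 - |ξ|^(-2s))/s` as `s → 0+`. The Riesz potential of order `2s` has symbol `|ξ|^(-2s)`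
and kernel `rieszConst N s * |x-y|^(2s-N)`, so its energy can be computed in both pictures.

In physical space, splitting the Riesz energy at `|x-y| = 1` and expanding in `s` shows that (norm
squared minus energy) divided by `s` tends to `formL u u` (`tendsto_formL`). On the Fourier side
(`rieszConst_mul_integral`), Bessel's inequality bounds the summed power spectra of `k` orthonormal
functions pointwise by `|Ω|`, while their total mass is at most `k`. The bathtub principle then
bounds the summed Riesz energies from above (`sum_rieszConst_mul_integral_le`). Dividing by `s` and
letting `s → 0` gives, for every `R > 0`, `∑ formL (f i) (f i) ≥ 2k ln R - d_N |Ω| R^N`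
(`sum_formL_ge`).

A dimension count turns the definition of `eigenvalue` into one orthonormal family whose forms are
controlled by the separate eigenvalues (`exists_orthonormal_formL_le`). The choice `R = 1` gives
(i). The maximizer `R^N = 2k/(N d_N |Ω|)` gives `(2k/N) ln(2k/(e N d_N |Ω|))`, which implies (ii)
and (iii). -/

/-! ### Radial powers on balls and Gaussian integrals. -/

theorem sphereArea_eq {N : ℕ} (hN : 1 ≤ N) :
    sphereArea N = 2 * π ^ ((N : ℝ) / 2) / Real.Gamma ((N : ℝ) / 2) := by
  have : Nonempty (Fin N) := ⟨⟨0, hN⟩⟩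
  have hN' : (0 : ℝ) < N := by exact_mod_cast hN
  have hG : 0 < Real.Gamma ((N : ℝ) / 2) := Real.Gamma_pos_of_pos (by positivity)
  rw [sphereArea, Measure.toSphere_real_apply_univ, finrank_euclideanSpace, measureReal_def,
    EuclideanSpace.volume_ball, Fintype.card_fin, ENNReal.ofReal_one, one_pow, one_mul,
    ENNReal.toReal_ofReal (by positivity), Real.Gamma_add_one (by positivity),
    Real.sqrt_eq_rpow, ← Real.rpow_natCast, ← Real.rpow_mul pi_nonneg,
    show (1 / 2 * (N : ℝ)) = N / 2 by ring]
  field_simp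

theorem sphereArea_pos {N : ℕ} (hN : 1 ≤ N) : 0 < sphereArea N := by
  have hN' : (0 : ℝ) < N := by exact_mod_cast hN
  rw [sphereArea_eq hN]
  positivity

theorem integrableOn_norm_rpow_ball {N : ℕ} (hN : 1 ≤ N) {a : ℝ} (ha : 0 < N + a) (R : ℝ) :
    IntegrableOn (fun x : EuclideanSpace ℝ (Fin N) => ‖x‖ ^ a) (Metric.ball 0 R) := by
  have : Nonempty (Fin N) := ⟨⟨0, hN⟩⟩
  rcases le_or_gt R 0 with hR | hR
  · simp [Metric.ball_eq_empty.mpr hR]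
  rw [integrableOn_fun_norm_addHaar (μ := volume) (f := fun r : ℝ => r ^ a), finrank_euclideanSpace,
    Fintype.card_fin]
  have h : IntegrableOn (fun y : ℝ => y ^ ((N : ℝ) + a - 1)) (Ioo 0 R) :=
    (intervalIntegral.integrableOn_Ioo_rpow_iff hR).2 (by linarith)
  refine h.congr_fun (fun y hy => ?_) measurableSet_Ioo
  simp only [smul_eq_mul]
  rw [← Real.rpow_natCast, ← Real.rpow_add hy.1]
  congr 1
  push_cast [Nat.cast_sub hN]
  ring

theorem integral_norm_rpow_ball {N : ℕ} (hN : 1 ≤ N) {a : ℝ} (ha : 0 < N + a) {R : ℝ}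
    (hR : 0 < R) :
    ∫ x in Metric.ball (0 : EuclideanSpace ℝ (Fin N)) R, ‖x‖ ^ a =
      sphereArea N * R ^ (N + a) / (N + a) := by
  have : Nonempty (Fin N) := ⟨⟨0, hN⟩⟩
  have h1 : ∫ x in Metric.ball (0 : EuclideanSpace ℝ (Fin N)) R, ‖x‖ ^ a =
      ∫ x : EuclideanSpace ℝ (Fin N), (Iio R).indicator (fun r : ℝ => r ^ a) ‖x‖ := by
    rw [← integral_indicator measurableSet_ball]
    refine integral_congr_ae (ae_of_all _ fun x => ?_)
    simp [indicator]
  rw [h1, integral_fun_norm_addHaar, finrank_euclideanSpace, Fintype.card_fin, sphereArea,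
    Measure.toSphere_real_apply_univ, finrank_euclideanSpace, Fintype.card_fin]
  have h2 : ∫ y in Ioi (0 : ℝ), y ^ (N - 1) • (Iio R).indicator (fun r : ℝ => r ^ a) y =
      ∫ y in Ioo 0 R, y ^ ((N : ℝ) + a - 1) := by
    rw [← integral_indicator measurableSet_Ioi, ← integral_indicator measurableSet_Ioo]
    refine integral_congr_ae (ae_of_all _ fun y => ?_)
    by_cases hy : y ∈ Ioo 0 R
    · have : y ∈ Ioi (0 : ℝ) := hy.1
      have h3 : y ∈ Iio R := hy.2
      simp only [indicator_of_mem, hy, this, h3, smul_eq_mul]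
      rw [← Real.rpow_natCast, ← Real.rpow_add hy.1]
      congr 1
      push_cast [Nat.cast_sub hN]
      ring
    · rw [indicator_of_notMem hy]
      by_cases h3 : y ∈ Ioi (0 : ℝ)
      · have : y ∉ Iio R := fun h => hy ⟨h3, h⟩
        simp [h3, this]
      · simp [indicator_of_notMem h3]
  rw [h2, ← integral_Ioc_eq_integral_Ioo, ← intervalIntegral.integral_of_le hR.le,
    integral_rpow (Or.inl (by linarith)), sub_add_cancel, Real.zero_rpow ha.ne', sub_zero]
  simp only [nsmul_eq_mul, smul_eq_mul]
  ring

theorem integrable_exp_neg_mul_sq_norm {N : ℕ} {b : ℝ} (hb : 0 < b) :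
    Integrable fun w : EuclideanSpace ℝ (Fin N) => Real.exp (-b * ‖w‖ ^ 2) := by
  have h := (GaussianFourier.integrable_cexp_neg_mul_sq_norm_add
    (V := EuclideanSpace ℝ (Fin N)) (b := (b : ℂ)) (by simpa using hb) 0 0).norm
  refine h.congr (ae_of_all _ fun w => ?_)
  simp only [Complex.norm_exp]
  congr 1
  norm_cast
  simp

/-- Real part of the Fourier transform of a Gaussian; `h = 0` gives its total mass. -/
theorem integral_exp_neg_mul_sq_norm_mul_cos {N : ℕ} {b : ℝ} (hb : 0 < b)
    (h : EuclideanSpace ℝ (Fin N)) :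
    ∫ w : EuclideanSpace ℝ (Fin N), Real.exp (-b * ‖w‖ ^ 2) * Real.cos (2 * π * inner ℝ h w) =
      (π / b) ^ ((N : ℝ) / 2) * Real.exp (-(π ^ 2 / b * ‖h‖ ^ 2)) := by
  have hb' : 0 < (b : ℂ).re := by simpa using hb
  have h1 := GaussianFourier.integral_cexp_neg_mul_sq_norm_add hb' (2 * π * Complex.I) h
  have hi := GaussianFourier.integrable_cexp_neg_mul_sq_norm_add hb' (2 * π * Complex.I) h
  have h2 := congrArg Complex.re h1
  have h3 := (RCLike.reCLM (K := ℂ)).integral_comp_comm hi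
  simp only [RCLike.reCLM_apply, RCLike.re_to_complex] at h3
  rw [← h3] at h2
  have h4 : ∀ w : EuclideanSpace ℝ (Fin N),
      (Complex.exp (-(b : ℂ) * (‖w‖ : ℂ) ^ 2 + 2 * π * Complex.I * (inner ℝ h w : ℝ))).re =
        Real.exp (-b * ‖w‖ ^ 2) * Real.cos (2 * π * inner ℝ h w) := by
    intro w
    rw [Complex.exp_re]
    congr 2 <;> norm_cast <;> simp [-Complex.ofReal_pow]
  simp only [h4] at h2
  rw [h2, finrank_euclideanSpace, Fintype.card_fin]
  have h5 : ((π : ℂ) / b) ^ ((N : ℂ) / 2) = (((π / b) ^ ((N : ℝ) / 2) : ℝ) : ℂ) := by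
    rw [Complex.ofReal_cpow (by positivity)]
    push_cast
    rfl
  have h6 : Complex.exp ((2 * (π : ℂ) * Complex.I) ^ 2 * (‖h‖ : ℂ) ^ 2 / (4 * b)) =
      ((Real.exp (-(π ^ 2 / b * ‖h‖ ^ 2)) : ℝ) : ℂ) := by
    push_cast
    congr 1
    have : (b : ℂ) ≠ 0 := by exact_mod_cast hb.ne'
    rw [mul_pow, Complex.I_sq]
    field_simp
    ring
  rw [h5, h6, ← Complex.ofReal_mul, Complex.ofReal_re]

/-! ### Double integrals against an even convolution kernel. -/

section Kernels

variable {N : ℕ} {f g u : EuclideanSpace ℝ (Fin N) → ℝ}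

theorem integrable_snd_mul_comp_sub (hf : Integrable f) (hg : Integrable g) :
    Integrable (fun p : EuclideanSpace ℝ (Fin N) × EuclideanSpace ℝ (Fin N) =>
      f p.2 * g (p.1 - p.2)) :=
  hf.convolution_integrand (ContinuousLinearMap.mul ℝ ℝ) hg

theorem integral_snd_mul_comp_sub (hf : Integrable f) (hg : Integrable g) :
    ∫ p : EuclideanSpace ℝ (Fin N) × EuclideanSpace ℝ (Fin N), f p.2 * g (p.1 - p.2) =
      (∫ x, f x) * ∫ x, g x := by
  rw [Measure.volume_eq_prod, integral_prod_symm _ (integrable_snd_mul_comp_sub hf hg)]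
  simp only [integral_const_mul, integral_sub_right_eq_self, integral_mul_const]

theorem integrable_fst_mul_comp_sub (hf : Integrable f) (hg : Integrable g)
    (hge : ∀ x, g (-x) = g x) :
    Integrable (fun p : EuclideanSpace ℝ (Fin N) × EuclideanSpace ℝ (Fin N) =>
      f p.1 * g (p.1 - p.2)) := by
  refine (integrable_snd_mul_comp_sub hf hg).swap.congr (ae_of_all _ fun p => ?_)
  simp [← hge (p.1 - p.2)]

theorem integral_fst_mul_comp_sub (hf : Integrable f) (hg : Integrable g)
    (hge : ∀ x, g (-x) = g x) :
    ∫ p : EuclideanSpace ℝ (Fin N) × EuclideanSpace ℝ (Fin N), f p.1 * g (p.1 - p.2) =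
      (∫ x, f x) * ∫ x, g x := by
  rw [← integral_snd_mul_comp_sub hf hg, Measure.volume_eq_prod, ← integral_prod_swap]
  refine integral_congr_ae (ae_of_all _ fun p => ?_)
  simp [← hge (p.1 - p.2)]

theorem aestronglyMeasurable_comp_sub (hg : Integrable g) :
    AEStronglyMeasurable (fun p : EuclideanSpace ℝ (Fin N) × EuclideanSpace ℝ (Fin N) =>
      g (p.1 - p.2)) :=
  hg.aestronglyMeasurable.comp_quasiMeasurePreserving
    (quasiMeasurePreserving_sub_of_right_invariant volume volume)

theorem integrable_mul_mul_comp_sub (hu : Measurable u) (hu2 : Integrable fun x => u x ^ 2)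
    (hg : Integrable g) (hge : ∀ x, g (-x) = g x) :
    Integrable (fun p : EuclideanSpace ℝ (Fin N) × EuclideanSpace ℝ (Fin N) =>
      u p.1 * u p.2 * g (p.1 - p.2)) := by
  have h1 := integrable_fst_mul_comp_sub hu2 hg.norm (by simp [hge])
  have h2 := integrable_snd_mul_comp_sub hu2 hg.norm
  refine (h1.add h2).mono' ?_ (ae_of_all _ fun p => ?_)
  · exact (((hu.comp measurable_fst).mul
      (hu.comp measurable_snd)).aestronglyMeasurable).mul (aestronglyMeasurable_comp_sub hg)
  · simp only [Pi.add_apply, norm_mul, ← add_mul]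
    refine mul_le_mul_of_nonneg_right ?_ (norm_nonneg _)
    rw [Real.norm_eq_abs, Real.norm_eq_abs, ← sq_abs (u p.1), ← sq_abs (u p.2)]
    nlinarith [sq_nonneg (|u p.1| - |u p.2|), sq_nonneg (|u p.1|), sq_nonneg (|u p.2|)]

/-- Expand the square: evenness of `g` makes both diagonal terms equal. With a Gaussian `g` this
yields half of Plancherel; with the truncated Riesz kernel it produces the near-diagonal part of
`formL`. -/
theorem integral_mul_mul_comp_sub (hu : Measurable u) (hu2 : Integrable fun x => u x ^ 2)
    (hg : Integrable g) (hge : ∀ x, g (-x) = g x) :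
    ∫ p : EuclideanSpace ℝ (Fin N) × EuclideanSpace ℝ (Fin N), u p.1 * u p.2 * g (p.1 - p.2) =
      (∫ x, u x ^ 2) * (∫ x, g x) -
        (∫ p : EuclideanSpace ℝ (Fin N) × EuclideanSpace ℝ (Fin N),
          (u p.1 - u p.2) ^ 2 * g (p.1 - p.2)) / 2 := by
  have h1 := integrable_fst_mul_comp_sub hu2 hg hge
  have h2 := integrable_snd_mul_comp_sub hu2 hg
  have h3 := integrable_mul_mul_comp_sub hu hu2 hg hge
  have h4 : ∫ p : EuclideanSpace ℝ (Fin N) × EuclideanSpace ℝ (Fin N),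
      (u p.1 - u p.2) ^ 2 * g (p.1 - p.2) =
      ((∫ x, u x ^ 2) * (∫ x, g x) + (∫ x, u x ^ 2) * (∫ x, g x)) -
      2 * ∫ p : EuclideanSpace ℝ (Fin N) × EuclideanSpace ℝ (Fin N),
        u p.1 * u p.2 * g (p.1 - p.2) := by
    nth_rewrite 1 [← integral_fst_mul_comp_sub hu2 hg hge]
    rw [← integral_snd_mul_comp_sub hu2 hg, ← integral_const_mul, ← integral_add' h1 h2,
      ← integral_sub (h1.add h2) (h3.const_mul 2)]
    refine integral_congr_ae (ae_of_all _ fun p => ?_)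
    simp only [Pi.add_apply]
    ring
  rw [h4]
  ring

end Kernels

/-! ### Power spectrum and the Plancherel inequality. -/

/-- The squared modulus at `w` of the Fourier transform of a real function. -/
noncomputable def powerSpectrum {N : ℕ} (u : EuclideanSpace ℝ (Fin N) → ℝ)
    (w : EuclideanSpace ℝ (Fin N)) : ℝ :=
  (∫ x, u x * Real.cos (2 * π * inner ℝ x w)) ^ 2 +
    (∫ x, u x * Real.sin (2 * π * inner ℝ x w)) ^ 2

section PowerSpectrum

variable {N : ℕ} {u : EuclideanSpace ℝ (Fin N) → ℝ}

theorem powerSpectrum_nonneg (u : EuclideanSpace ℝ (Fin N) → ℝ) (w) : 0 ≤ powerSpectrum u w := by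
  unfold powerSpectrum
  positivity

theorem integrable_mul_cos (hu : Integrable u) (w : EuclideanSpace ℝ (Fin N)) :
    Integrable fun x => u x * Real.cos (2 * π * inner ℝ x w) :=
  hu.mul_bdd (c := 1) (by fun_prop) (ae_of_all _ fun x => Real.abs_cos_le_one _)

theorem integrable_mul_sin (hu : Integrable u) (w : EuclideanSpace ℝ (Fin N)) :
    Integrable fun x => u x * Real.sin (2 * π * inner ℝ x w) :=
  hu.mul_bdd (c := 1) (by fun_prop) (ae_of_all _ fun x => Real.abs_sin_le_one _)

theorem continuous_powerSpectrum (hu : Integrable u) : Continuous (powerSpectrum u) := by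
  refine Continuous.add (Continuous.pow ?_ 2) (Continuous.pow ?_ 2)
  · refine continuous_of_dominated (bound := fun x => |u x|)
      (fun w => (integrable_mul_cos hu w).aestronglyMeasurable)
      (fun w => ae_of_all _ fun x => ?_) hu.abs (ae_of_all _ fun x => by fun_prop)
    rw [Real.norm_eq_abs, abs_mul]
    exact mul_le_of_le_one_right (abs_nonneg _) (Real.abs_cos_le_one _)
  · refine continuous_of_dominated (bound := fun x => |u x|)
      (fun w => (integrable_mul_sin hu w).aestronglyMeasurable)
      (fun w => ae_of_all _ fun x => ?_) hu.abs (ae_of_all _ fun x => by fun_prop)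
    rw [Real.norm_eq_abs, abs_mul]
    exact mul_le_of_le_one_right (abs_nonneg _) (Real.abs_sin_le_one _)

theorem powerSpectrum_eq_integral (hu : Integrable u) (w : EuclideanSpace ℝ (Fin N)) :
    powerSpectrum u w = ∫ p : EuclideanSpace ℝ (Fin N) × EuclideanSpace ℝ (Fin N),
      u p.1 * u p.2 * Real.cos (2 * π * inner ℝ (p.1 - p.2) w) := by
  rw [powerSpectrum, sq, sq, ← integral_prod_mul, ← integral_prod_mul, ← integral_add
    ((integrable_mul_cos hu w).mul_prod (integrable_mul_cos hu w))
    ((integrable_mul_sin hu w).mul_prod (integrable_mul_sin hu w)), Measure.volume_eq_prod]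
  refine integral_congr_ae (ae_of_all _ fun p => ?_)
  simp only [inner_sub_left, mul_sub, Real.cos_sub]
  ring

/-- The right side is the square of the `L¹` norm of `u`: a uniform bound that serves as a
dominating constant. -/
theorem powerSpectrum_le (hu : Integrable u) (w : EuclideanSpace ℝ (Fin N)) :
    powerSpectrum u w ≤ powerSpectrum (fun x => |u x|) 0 := by
  rw [powerSpectrum_eq_integral hu, powerSpectrum_eq_integral hu.abs]
  have hi : Integrable fun p : EuclideanSpace ℝ (Fin N) × EuclideanSpace ℝ (Fin N) =>
    u p.1 * u p.2 := hu.mul_prod hu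
  refine integral_mono (hi.mul_bdd (c := 1) (by fun_prop)
    (ae_of_all _ fun x => Real.abs_cos_le_one _)) ?_ fun p => ?_
  · simp only [inner_zero_right, mul_zero, Real.cos_zero, mul_one]
    exact hu.abs.mul_prod hu.abs
  · simp only [inner_zero_right, mul_zero, Real.cos_zero, mul_one]
    refine (le_abs_self _).trans ?_
    rw [abs_mul, abs_mul]
    exact mul_le_of_le_one_right (by positivity) (Real.abs_cos_le_one _)

/-- The Fourier side of the Gaussian quadratic form. -/
theorem integral_gaussian_mul_powerSpectrum (hu : Integrable u) {b : ℝ} (hb : 0 < b) :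
    ∫ w, Real.exp (-b * ‖w‖ ^ 2) * powerSpectrum u w =
      ∫ p : EuclideanSpace ℝ (Fin N) × EuclideanSpace ℝ (Fin N), u p.1 * u p.2 *
        ((π / b) ^ ((N : ℝ) / 2) * Real.exp (-(π ^ 2 / b * ‖p.1 - p.2‖ ^ 2))) := by
  have hi : Integrable fun p : EuclideanSpace ℝ (Fin N) × EuclideanSpace ℝ (Fin N) =>
    u p.1 * u p.2 := hu.mul_prod hu
  have hint : Integrable (Function.uncurry fun (w : EuclideanSpace ℝ (Fin N))
      (p : EuclideanSpace ℝ (Fin N) × EuclideanSpace ℝ (Fin N)) =>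
      (Real.exp (-b * ‖w‖ ^ 2) * (u p.1 * u p.2)) *
        Real.cos (2 * π * inner ℝ (p.1 - p.2) w)) (volume.prod volume) :=
    ((integrable_exp_neg_mul_sq_norm hb).mul_prod hi).mul_bdd (c := 1) (by fun_prop)
      (ae_of_all _ fun x => Real.abs_cos_le_one _)
  have h := integral_integral_swap hint
  have h1 : ∀ w, ∫ p : EuclideanSpace ℝ (Fin N) × EuclideanSpace ℝ (Fin N),
      (Real.exp (-b * ‖w‖ ^ 2) * (u p.1 * u p.2)) * Real.cos (2 * π * inner ℝ (p.1 - p.2) w) =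
      Real.exp (-b * ‖w‖ ^ 2) * powerSpectrum u w := by
    intro w
    simp only [powerSpectrum_eq_integral hu, mul_assoc, integral_const_mul]
  simp only [h1] at h
  rw [h]
  refine integral_congr_ae (ae_of_all _ fun p => ?_)
  simp only
  rw [← integral_exp_neg_mul_sq_norm_mul_cos hb, ← integral_const_mul]
  refine integral_congr_ae (ae_of_all _ fun w => ?_)
  simp only
  ring

theorem integrable_gaussian_mul_powerSpectrum (hu : Integrable u) {b : ℝ} (hb : 0 < b) :
    Integrable fun w => Real.exp (-b * ‖w‖ ^ 2) * powerSpectrum u w :=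
  (integrable_exp_neg_mul_sq_norm hb).mul_bdd
    (continuous_powerSpectrum hu).aestronglyMeasurable
    (ae_of_all _ fun w => (abs_of_nonneg (powerSpectrum_nonneg u w)).le.trans
      (powerSpectrum_le hu w))

/-- The Gaussian on the physical side has mass one, and the squared-difference term in
`integral_mul_mul_comp_sub` enters with a favourable sign. -/
theorem integral_gaussian_mul_powerSpectrum_le (hu : Integrable u) (hm : Measurable u)
    (hu2 : Integrable fun x => u x ^ 2) {b : ℝ} (hb : 0 < b) :
    ∫ w, Real.exp (-b * ‖w‖ ^ 2) * powerSpectrum u w ≤ ∫ x, u x ^ 2 := by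
  have hc : 0 < π ^ 2 / b := by positivity
  have hg : Integrable fun h : EuclideanSpace ℝ (Fin N) =>
      (π / b) ^ ((N : ℝ) / 2) * Real.exp (-(π ^ 2 / b * ‖h‖ ^ 2)) := by
    simpa using (integrable_exp_neg_mul_sq_norm (N := N) hc).const_mul ((π / b) ^ ((N : ℝ) / 2))
  have h1 : ∫ h : EuclideanSpace ℝ (Fin N),
      (π / b) ^ ((N : ℝ) / 2) * Real.exp (-(π ^ 2 / b * ‖h‖ ^ 2)) = 1 := by
    have h2 := integral_exp_neg_mul_sq_norm_mul_cos hc (0 : EuclideanSpace ℝ (Fin N))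
    simp only [inner_zero_left, mul_zero, Real.cos_zero, mul_one, norm_zero, neg_mul, neg_zero,
      Real.exp_zero, ne_eq, OfNat.ofNat_ne_zero, not_false_eq_true, zero_pow] at h2
    rw [integral_const_mul, h2, ← Real.mul_rpow (by positivity) (by positivity)]
    have : π / b * (π / (π ^ 2 / b)) = 1 := by field_simp
    rw [this, Real.one_rpow]
  rw [integral_gaussian_mul_powerSpectrum hu hb,
    integral_mul_mul_comp_sub hm hu2 hg (by simp), h1, mul_one]
  have : 0 ≤ ∫ p : EuclideanSpace ℝ (Fin N) × EuclideanSpace ℝ (Fin N), (u p.1 - u p.2) ^ 2 *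
      ((π / b) ^ ((N : ℝ) / 2) * Real.exp (-(π ^ 2 / b * ‖p.1 - p.2‖ ^ 2))) :=
    integral_nonneg fun p => by positivity
  linarith

/-- Fatou's lemma along `b = 1/(n+1) → 0`. This half of Plancherel is enough, since the spectral
mass is only ever bounded from above. -/
theorem lintegral_powerSpectrum_le (hu : Integrable u) (hm : Measurable u)
    (hu2 : Integrable fun x => u x ^ 2) :
    ∫⁻ w, ENNReal.ofReal (powerSpectrum u w) ≤ ENNReal.ofReal (∫ x, u x ^ 2) := by
  have hb : ∀ n : ℕ, (0 : ℝ) < 1 / ((n : ℝ) + 1) := fun n => by positivity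
  have hlim : ∀ w, Tendsto (fun n : ℕ => ENNReal.ofReal
      (Real.exp (-(1 / ((n : ℝ) + 1)) * ‖w‖ ^ 2) * powerSpectrum u w)) atTop
      (𝓝 (ENNReal.ofReal (powerSpectrum u w))) := by
    intro w
    refine ENNReal.tendsto_ofReal ?_
    have h := ((Real.continuous_exp.tendsto 0).comp
      (((tendsto_one_div_add_atTop_nhds_zero_nat (𝕜 := ℝ)).neg.mul_const (‖w‖ ^ 2)).trans
        (by simp))).mul_const (powerSpectrum u w)
    simpa [Function.comp_def] using h
  calc ∫⁻ w, ENNReal.ofReal (powerSpectrum u w)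
      = ∫⁻ w, liminf (fun n : ℕ => ENNReal.ofReal
          (Real.exp (-(1 / ((n : ℝ) + 1)) * ‖w‖ ^ 2) * powerSpectrum u w)) atTop :=
        lintegral_congr fun w => (hlim w).liminf_eq.symm
    _ ≤ liminf (fun n : ℕ => ∫⁻ w, ENNReal.ofReal
          (Real.exp (-(1 / ((n : ℝ) + 1)) * ‖w‖ ^ 2) * powerSpectrum u w)) atTop :=
        lintegral_liminf_le' fun n =>
          (integrable_gaussian_mul_powerSpectrum hu
            (hb n)).aestronglyMeasurable.aemeasurable.ennreal_ofReal
    _ ≤ ENNReal.ofReal (∫ x, u x ^ 2) := by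
        refine liminf_le_of_frequently_le' (Frequently.of_forall fun n => ?_)
        rw [← ofReal_integral_eq_lintegral_ofReal
          (integrable_gaussian_mul_powerSpectrum hu (hb n))
          (ae_of_all _ fun w => mul_nonneg (Real.exp_pos _).le (powerSpectrum_nonneg u w))]
        exact ENNReal.ofReal_le_ofReal (integral_gaussian_mul_powerSpectrum_le hu hm hu2 (hb n))

theorem integrable_powerSpectrum (hu : Integrable u) (hm : Measurable u)
    (hu2 : Integrable fun x => u x ^ 2) : Integrable (powerSpectrum u) := by
  refine ⟨(continuous_powerSpectrum hu).aestronglyMeasurable, ?_⟩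
  rw [hasFiniteIntegral_iff_ofReal (ae_of_all _ (powerSpectrum_nonneg u))]
  exact (lintegral_powerSpectrum_le hu hm hu2).trans_lt ENNReal.ofReal_lt_top

theorem integral_powerSpectrum_le (hu : Integrable u) (hm : Measurable u)
    (hu2 : Integrable fun x => u x ^ 2) : ∫ w, powerSpectrum u w ≤ ∫ x, u x ^ 2 := by
  have h := lintegral_powerSpectrum_le hu hm hu2
  rw [← ofReal_integral_eq_lintegral_ofReal (integrable_powerSpectrum hu hm hu2)
    (ae_of_all _ (powerSpectrum_nonneg u))] at h
  exact (ENNReal.ofReal_le_ofReal_iff (integral_nonneg fun x => sq_nonneg _)).1 h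

end PowerSpectrum

/-! ### Bessel's inequality and the pointwise spectral bound. -/

/-- Bessel's inequality for finitely many orthonormal real functions. -/
theorem sum_sq_integral_mul_le {α : Type*} [MeasurableSpace α] {μ : Measure α} {k : ℕ}
    {f : Fin k → α → ℝ} {g : α → ℝ} (hf : ∀ i, MemLp (f i) 2 μ) (hg : MemLp g 2 μ)
    (ho : ∀ i j, ∫ x, f i x * f j x ∂μ = if i = j then 1 else 0) :
    ∑ i, (∫ x, f i x * g x ∂μ) ^ 2 ≤ ∫ x, g x ^ 2 ∂μ := by
  have hin : ∀ {a b : α → ℝ} (ha : MemLp a 2 μ) (hb : MemLp b 2 μ),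
      inner ℝ (ha.toLp a) (hb.toLp b) = ∫ x, a x * b x ∂μ := by
    intro a b ha hb
    rw [L2.inner_def]
    refine integral_congr_ae ?_
    filter_upwards [ha.coeFn_toLp, hb.coeFn_toLp] with x h1 h2
    rw [h1, h2]
    simp [mul_comm]
  have hv : Orthonormal ℝ fun i => (hf i).toLp (f i) := by
    rw [orthonormal_iff_ite]
    intro i j
    rw [hin, ho]
  have h := hv.sum_inner_products_le (hg.toLp g) (s := Finset.univ)
  rw [← real_inner_self_eq_norm_sq] at h
  simp only [hin, ← sq, Real.norm_eq_abs, sq_abs] at h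
  exact h

/-- Bessel's inequality on `Ω` for the cosine and the sine of frequency `w`; the two right sides add
up to `|Ω|` because `cos² + sin² = 1`. -/
theorem sum_powerSpectrum_le {N k : ℕ} {Ω : Set (EuclideanSpace ℝ (Fin N))}
    (hfin : volume Ω ≠ ⊤)
    {f : Fin k → EuclideanSpace ℝ (Fin N) → ℝ} (hf : ∀ i, MemLp (f i) 2 volume)
    (h0 : ∀ i, ∀ x ∉ Ω, f i x = 0)
    (ho : ∀ i j, ∫ x in Ω, f i x * f j x = if i = j then 1 else 0)
    (w : EuclideanSpace ℝ (Fin N)) :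
    ∑ i, powerSpectrum (f i) w ≤ volume.real Ω := by
  have : IsFiniteMeasure (volume.restrict Ω) := ⟨by simpa using hfin.lt_top⟩
  have hc : MemLp (fun x : EuclideanSpace ℝ (Fin N) => Real.cos (2 * π * inner ℝ x w)) 2
      (volume.restrict Ω) :=
    MemLp.of_bound (by fun_prop) 1 (ae_of_all _ fun x => Real.abs_cos_le_one _)
  have hs : MemLp (fun x : EuclideanSpace ℝ (Fin N) => Real.sin (2 * π * inner ℝ x w)) 2
      (volume.restrict Ω) :=
    MemLp.of_bound (by fun_prop) 1 (ae_of_all _ fun x => Real.abs_sin_le_one _)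
  have h1 := sum_sq_integral_mul_le (fun i => (hf i).restrict Ω) hc ho
  have h2 := sum_sq_integral_mul_le (fun i => (hf i).restrict Ω) hs ho
  have hr : ∀ (i : Fin k) (g : EuclideanSpace ℝ (Fin N) → ℝ),
      ∫ x in Ω, f i x * g x = ∫ x, f i x * g x := fun i g =>
    setIntegral_eq_integral_of_forall_compl_eq_zero fun x hx => by rw [h0 i x hx, zero_mul]
  simp only [hr] at h1 h2
  have h3 : (∫ x in Ω, Real.cos (2 * π * inner ℝ x w) ^ 2) +
      ∫ x in Ω, Real.sin (2 * π * inner ℝ x w) ^ 2 = volume.real Ω := by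
    rw [← integral_add hc.integrable_sq hs.integrable_sq]
    simp
  simp only [powerSpectrum, Finset.sum_add_distrib]
  linarith

/-! ### Riesz energies as superpositions of Gaussian energies. -/

/-- Fubini for a mixture `k = ∫ K b db`. Since `K ≥ 0`, integrating `|g K|` in `b` gives `|g| k`, so
integrability of `g * k` is all that has to be known. -/
theorem integral_Ioi_integral_mul_eq {X : Type*} [MeasurableSpace X] {μ : Measure X} [SFinite μ]
    {K : ℝ → X → ℝ} {g k : X → ℝ} (hK : Measurable (Function.uncurry K))
    (hK0 : ∀ b ∈ Ioi (0 : ℝ), ∀ x, 0 ≤ K b x) (hg : AEStronglyMeasurable g μ)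
    (hKi : ∀ᵐ x ∂μ, IntegrableOn (fun b => K b x) (Ioi 0))
    (hKk : ∀ᵐ x ∂μ, ∫ b in Ioi 0, K b x = k x) (hgk : Integrable (fun x => g x * k x) μ) :
    ∫ b in Ioi (0 : ℝ), ∫ x, g x * K b x ∂μ = ∫ x, g x * k x ∂μ := by
  have hm : AEStronglyMeasurable (Function.uncurry fun b x => g x * K b x)
      ((volume.restrict (Ioi (0 : ℝ))).prod μ) :=
    (hg.comp_snd).mul hK.aestronglyMeasurable
  have hint : Integrable (Function.uncurry fun b x => g x * K b x)
      ((volume.restrict (Ioi (0 : ℝ))).prod μ) := by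
    rw [integrable_prod_iff' hm]
    constructor
    · filter_upwards [hKi] with x hx
      exact hx.const_mul (g x)
    · refine hgk.norm.congr ?_
      filter_upwards [hKk] with x hx
      simp only [Function.uncurry, norm_mul, integral_const_mul]
      congr 1
      rw [← hx, Real.norm_eq_abs, abs_of_nonneg (setIntegral_nonneg measurableSet_Ioi
        fun b hb => hK0 b hb x)]
      refine setIntegral_congr_fun measurableSet_Ioi fun b hb => ?_
      exact (abs_of_nonneg (hK0 b hb x)).symm
  rw [integral_integral_swap hint]
  refine integral_congr_ae ?_
  filter_upwards [hKk] with x hx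
  rw [integral_const_mul, hx]

theorem integrableOn_rpow_mul_exp_neg_mul {a r : ℝ} (ha : 0 < a) (hr : 0 < r) :
    IntegrableOn (fun t : ℝ => t ^ (a - 1) * Real.exp (-(r * t))) (Ioi 0) := by
  have h := integrableOn_rpow_mul_exp_neg_mul_rpow (s := a - 1) (p := 1) (b := r)
    (by linarith) one_pos hr
  simpa using h

/-- The substitution `t ↦ 1/t`, Jacobian included, which turns the inverse-Gamma integrand into the
Gamma integrand. -/
theorem rpow_neg_mul_exp_neg_div_eq {a r t : ℝ} (ht : t ∈ Ioi (0 : ℝ)) :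
    (|(-1 : ℝ)| * t ^ ((-1 : ℝ) - 1)) • ((t ^ (-1 : ℝ)) ^ (a - 1) *
      Real.exp (-(r * t ^ (-1 : ℝ)))) = t ^ (-a - 1) * Real.exp (-(r / t)) := by
  have ht : 0 < t := ht
  rw [smul_eq_mul, ← Real.rpow_mul ht.le, abs_neg, abs_one, one_mul, ← mul_assoc,
    ← Real.rpow_add ht, Real.rpow_neg_one, div_eq_mul_inv]
  congr 2
  ring

theorem integrableOn_rpow_neg_mul_exp_neg_div {a r : ℝ} (ha : 0 < a) (hr : 0 < r) :
    IntegrableOn (fun t : ℝ => t ^ (-a - 1) * Real.exp (-(r / t))) (Ioi 0) :=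
  ((integrableOn_Ioi_comp_rpow_iff _ (by norm_num : (-1 : ℝ) ≠ 0)).2
    (integrableOn_rpow_mul_exp_neg_mul ha hr)).congr_fun
    (fun _ ht => rpow_neg_mul_exp_neg_div_eq ht) measurableSet_Ioi

theorem integral_rpow_neg_mul_exp_neg_div {a r : ℝ} (ha : 0 < a) (hr : 0 < r) :
    ∫ t in Ioi (0 : ℝ), t ^ (-a - 1) * Real.exp (-(r / t)) = (1 / r) ^ a * Real.Gamma a := by
  rw [← Real.integral_rpow_mul_exp_neg_mul_Ioi ha hr,
    ← integral_comp_rpow_Ioi (fun t : ℝ => t ^ (a - 1) * Real.exp (-(r * t)))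
      (by norm_num : (-1 : ℝ) ≠ 0)]
  exact (setIntegral_congr_fun measurableSet_Ioi
    fun t ht => rpow_neg_mul_exp_neg_div_eq ht).symm

/-- The normalization constant of the Riesz kernel of order `2 s`. -/
noncomputable def rieszConst (N : ℕ) (s : ℝ) : ℝ :=
  Real.Gamma ((N : ℝ) / 2 - s) / (4 ^ s * π ^ ((N : ℝ) / 2) * Real.Gamma s)

section Riesz

variable {N : ℕ} {u : EuclideanSpace ℝ (Fin N) → ℝ}

theorem ae_ne_zero (hN : 1 ≤ N) : ∀ᵐ x : EuclideanSpace ℝ (Fin N), x ≠ 0 := by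
  have : Nonempty (Fin N) := ⟨⟨0, hN⟩⟩
  exact Measure.ae_ne volume 0

theorem ae_fst_ne_snd (hN : 1 ≤ N) :
    ∀ᵐ p : EuclideanSpace ℝ (Fin N) × EuclideanSpace ℝ (Fin N), p.1 - p.2 ≠ 0 :=
  (quasiMeasurePreserving_sub_of_right_invariant volume volume).ae (ae_ne_zero hN)

theorem indicator_ball_neg (a : ℝ) (x : EuclideanSpace ℝ (Fin N)) :
    (Metric.ball (0 : EuclideanSpace ℝ (Fin N)) 1).indicator (fun y => ‖y‖ ^ a) (-x) =
      (Metric.ball (0 : EuclideanSpace ℝ (Fin N)) 1).indicator (fun y => ‖y‖ ^ a) x := by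
  simp [indicator]

/-- Within distance one the kernel is integrable and `u ∈ L²` suffices; beyond it the kernel is at
most one and `u ∈ L¹` suffices. -/
theorem integrable_mul_mul_norm_sub_rpow (hN : 1 ≤ N) (hu : Measurable u) (hu1 : Integrable u)
    (hu2 : Integrable fun x => u x ^ 2) {a : ℝ} (ha : 0 < N + a) (ha0 : a ≤ 0) :
    Integrable (fun p : EuclideanSpace ℝ (Fin N) × EuclideanSpace ℝ (Fin N) =>
      u p.1 * u p.2 * ‖p.1 - p.2‖ ^ a) := by
  have h1 := (integrable_mul_mul_comp_sub hu hu2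
    ((integrable_indicator_iff measurableSet_ball).2 (integrableOn_norm_rpow_ball hN ha 1))
    (indicator_ball_neg a)).norm
  have h2 : Integrable (fun p : EuclideanSpace ℝ (Fin N) × EuclideanSpace ℝ (Fin N) =>
    u p.1 * u p.2) := hu1.mul_prod hu1
  refine (h1.add h2.norm).mono' ?_ (ae_of_all _ fun p => ?_)
  · exact Measurable.aestronglyMeasurable (by fun_prop)
  · simp only [Pi.add_apply, norm_mul]
    have hn : 0 ≤ ‖u p.1‖ * ‖u p.2‖ := by positivity
    by_cases hp : ‖p.1 - p.2‖ < 1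
    · rw [indicator_of_mem (by simpa using hp)]
      linarith
    · have h3 : ‖p.1 - p.2‖ ^ a ≤ 1 := Real.rpow_le_one_of_one_le_of_nonpos (not_lt.1 hp) ha0
      have h4 : 0 ≤ ‖p.1 - p.2‖ ^ a := by positivity
      rw [Real.norm_of_nonneg h4]
      have h5 : 0 ≤ ‖u p.1‖ * ‖u p.2‖ *
        ‖(Metric.ball (0 : EuclideanSpace ℝ (Fin N)) 1).indicator (fun y => ‖y‖ ^ a)
          (p.1 - p.2)‖ := by positivity
      nlinarith

theorem integrable_powerSpectrum_mul_norm_rpow (hN : 1 ≤ N) (hu : Measurable u)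
    (hu1 : Integrable u) (hu2 : Integrable fun x => u x ^ 2) {a : ℝ} (ha : 0 < N + a)
    (ha0 : a ≤ 0) : Integrable fun w => powerSpectrum u w * ‖w‖ ^ a := by
  have h1 := ((integrable_indicator_iff measurableSet_ball).2
    (integrableOn_norm_rpow_ball hN ha 1)).const_mul (powerSpectrum (fun x => |u x|) 0)
  have h2 := integrable_powerSpectrum hu1 hu hu2
  refine (h1.add h2).mono' ?_ (ae_of_all _ fun w => ?_)
  · exact (continuous_powerSpectrum hu1).aestronglyMeasurable.mul
      (Measurable.aestronglyMeasurable (by fun_prop))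
  · have hP := powerSpectrum_nonneg u w
    have hw : 0 ≤ ‖w‖ ^ a := by positivity
    rw [Pi.add_apply, Real.norm_of_nonneg (mul_nonneg hP hw)]
    by_cases hp : ‖w‖ < 1
    · rw [indicator_of_mem (by simpa using hp)]
      nlinarith [powerSpectrum_le hu1 w]
    · rw [indicator_of_notMem (by simpa using hp)]
      have h3 : ‖w‖ ^ a ≤ 1 := Real.rpow_le_one_of_one_le_of_nonpos (not_lt.1 hp) ha0
      nlinarith

/-- The Riesz potential energy on the Fourier side. -/
theorem rieszConst_mul_integral (hN : 1 ≤ N) (hu : Measurable u)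
    (hu1 : Integrable u) (hu2 : Integrable fun x => u x ^ 2) {s : ℝ} (hs : 0 < s)
    (hsN : 2 * s < N) :
    rieszConst N s * ∫ p : EuclideanSpace ℝ (Fin N) × EuclideanSpace ℝ (Fin N),
        u p.1 * u p.2 * ‖p.1 - p.2‖ ^ (2 * s - N) =
      (2 * π) ^ (-(2 * s)) * ∫ w, powerSpectrum u w * ‖w‖ ^ (-(2 * s)) := by
  have hGs : 0 < Real.Gamma s := Real.Gamma_pos_of_pos hs
  have hα : 0 < (N : ℝ) / 2 - s := by linarith
  -- The Gaussian identity is integrated against `b^(s-1) db`. On the Fourier side this gives `Γ(s)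
  -- |w|^(-2s)`.
  have hF := integral_Ioi_integral_mul_eq (μ := volume)
    (K := fun b (w : EuclideanSpace ℝ (Fin N)) => b ^ (s - 1) * Real.exp (-(‖w‖ ^ 2 * b)))
    (g := powerSpectrum u) (k := fun w => ‖w‖ ^ (-(2 * s)) * Real.Gamma s)
    (by fun_prop) (fun b hb w => mul_nonneg (Real.rpow_nonneg (le_of_lt hb) _)
      (Real.exp_pos _).le)
    (continuous_powerSpectrum hu1).aestronglyMeasurable
    (by
      filter_upwards [ae_ne_zero hN] with w hw
      exact integrableOn_rpow_mul_exp_neg_mul hs (by positivity))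
    (by
      filter_upwards [ae_ne_zero hN] with w hw
      have hw' : 0 < ‖w‖ := norm_pos_iff.2 hw
      rw [Real.integral_rpow_mul_exp_neg_mul_Ioi hs (by positivity), one_div,
        Real.inv_rpow (by positivity), ← Real.rpow_natCast, ← Real.rpow_mul hw'.le,
        ← Real.rpow_neg hw'.le]
      norm_num)
    (by
      simp only [← mul_assoc]
      exact (integrable_powerSpectrum_mul_norm_rpow hN hu hu1 hu2 (by linarith)
        (by linarith)).mul_const _)
  -- On the physical side the weight combines with `(π/b)^(N/2)` into `b^(-(N/2-s)-1)`, and the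
  -- integral is a multiple of `|x-y|^(2s-N)`.
  have hX := integral_Ioi_integral_mul_eq (μ := volume)
    (K := fun b (p : EuclideanSpace ℝ (Fin N) × EuclideanSpace ℝ (Fin N)) =>
      π ^ ((N : ℝ) / 2) *
        (b ^ (-((N : ℝ) / 2 - s) - 1) * Real.exp (-(π ^ 2 * ‖p.1 - p.2‖ ^ 2 / b))))
    (g := fun p => u p.1 * u p.2) (k := fun p => ‖p.1 - p.2‖ ^ (2 * s - N) *
      (π ^ ((N : ℝ) / 2) * (π ^ (2 * s - N) * Real.Gamma ((N : ℝ) / 2 - s))))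
    (by fun_prop) (fun b hb w => mul_nonneg (by positivity)
      (mul_nonneg (Real.rpow_nonneg (le_of_lt hb) _) (Real.exp_pos _).le))
    (Measurable.aestronglyMeasurable (by fun_prop))
    (by
      filter_upwards [ae_fst_ne_snd hN] with p hp
      have hp' : 0 < ‖p.1 - p.2‖ := norm_pos_iff.2 hp
      exact (integrableOn_rpow_neg_mul_exp_neg_div hα (by positivity)).const_mul _)
    (by
      filter_upwards [ae_fst_ne_snd hN] with p hp
      have hp' : 0 < ‖p.1 - p.2‖ := norm_pos_iff.2 hp
      rw [integral_const_mul, integral_rpow_neg_mul_exp_neg_div hα (by positivity), one_div,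
        ← mul_pow, Real.inv_rpow (by positivity), ← Real.rpow_natCast,
        ← Real.rpow_mul (by positivity), ← Real.rpow_neg (by positivity),
        Real.mul_rpow pi_nonneg hp'.le,
        show -(((2 : ℕ) : ℝ) * ((N : ℝ) / 2 - s)) = 2 * s - N by push_cast; ring]
      ring)
    (by
      simp only [← mul_assoc]
      exact ((((integrable_mul_mul_norm_sub_rpow hN hu hu1 hu2 (by linarith)
        (by linarith)).mul_const _).mul_const _).mul_const _))
  have hFX : ∫ b in Ioi (0 : ℝ), ∫ w : EuclideanSpace ℝ (Fin N), powerSpectrum u w *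
        (b ^ (s - 1) * Real.exp (-(‖w‖ ^ 2 * b))) =
      ∫ b in Ioi (0 : ℝ), ∫ p : EuclideanSpace ℝ (Fin N) × EuclideanSpace ℝ (Fin N),
        u p.1 * u p.2 * (π ^ ((N : ℝ) / 2) *
        (b ^ (-((N : ℝ) / 2 - s) - 1) * Real.exp (-(π ^ 2 * ‖p.1 - p.2‖ ^ 2 / b)))) := by
    refine setIntegral_congr_fun measurableSet_Ioi fun b hb => ?_
    have hb : 0 < b := hb
    have h := congrArg (fun z => b ^ (s - 1) * z) (integral_gaussian_mul_powerSpectrum hu1 hb)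
    simp only [← integral_const_mul] at h
    convert h using 1
    · refine integral_congr_ae (ae_of_all _ fun w => ?_)
      simp only
      rw [show -(‖w‖ ^ 2 * b) = -b * ‖w‖ ^ 2 by ring]
      ring
    · refine integral_congr_ae (ae_of_all _ fun p => ?_)
      simp only
      rw [show -((N : ℝ) / 2 - s) - 1 = (s - 1) - (N : ℝ) / 2 by ring, Real.rpow_sub hb (s - 1),
        Real.div_rpow pi_nonneg hb.le,
        show -(π ^ 2 * ‖p.1 - p.2‖ ^ 2 / b) = -(π ^ 2 / b * ‖p.1 - p.2‖ ^ 2) by ring]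
      ring
  rw [hF, hX] at hFX
  simp only [← mul_assoc, integral_mul_const] at hFX
  have hpN : π ^ (2 * s - (N : ℝ)) = π ^ (2 * s) / (π ^ ((N : ℝ) / 2)) ^ 2 := by
    rw [Real.rpow_sub pi_pos, ← Real.rpow_natCast, ← Real.rpow_mul pi_nonneg]
    norm_num
  have h4 : (2 * π) ^ (-(2 * s)) = 1 / (4 ^ s * π ^ (2 * s)) := by
    rw [Real.rpow_neg (by positivity), Real.mul_rpow (by norm_num) pi_nonneg,
      Real.rpow_mul (by norm_num)]
    norm_num
  have hP0 : 0 < π ^ ((N : ℝ) / 2) := by positivity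
  have hP1 : 0 < π ^ (2 * s) := by positivity
  rw [hpN] at hFX
  rw [rieszConst, h4]
  field_simp
  field_simp at hFX
  linarith

/-- The bathtub estimate for Riesz energies of orthonormal functions. -/
theorem sum_rieszConst_mul_integral_le (hN : 1 ≤ N) {k : ℕ}
    {Ω : Set (EuclideanSpace ℝ (Fin N))} (hfin : volume Ω ≠ ⊤)
    {f : Fin k → EuclideanSpace ℝ (Fin N) → ℝ} (hm : ∀ i, Measurable (f i))
    (hf1 : ∀ i, Integrable (f i)) (hf : ∀ i, MemLp (f i) 2 volume)
    (h0 : ∀ i, ∀ x ∉ Ω, f i x = 0)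
    (ho : ∀ i j, ∫ x in Ω, f i x * f j x = if i = j then 1 else 0)
    {s : ℝ} (hs : 0 < s) (hsN : 2 * s < N) {R : ℝ} (hR : 0 < R) :
    ∑ i, rieszConst N s * ∫ p : EuclideanSpace ℝ (Fin N) × EuclideanSpace ℝ (Fin N),
        f i p.1 * f i p.2 * ‖p.1 - p.2‖ ^ (2 * s - N) ≤
      k * R ^ (-(2 * s)) + volume.real Ω * (sphereArea N * R ^ ((N : ℝ) - 2 * s) *
        (2 * s / (N * (N - 2 * s))) / (2 * π) ^ N) := by
  have hN' : (0 : ℝ) < N := by exact_mod_cast hN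
  -- The transform uses frequencies `2πw`, so radius `R` in `ξ` is radius `R/(2π)` in `w`.
  set ρ : ℝ := R / (2 * π) with hρ
  have hρ0 : 0 < ρ := by positivity
  have hi : ∀ i, Integrable fun w => powerSpectrum (f i) w * ‖w‖ ^ (-(2 * s)) := fun i =>
    integrable_powerSpectrum_mul_norm_rpow hN (hm i) (hf1 i) (hf i).integrable_sq (by linarith)
      (by linarith)
  have hP : ∀ i, Integrable (powerSpectrum (f i)) := fun i =>
    integrable_powerSpectrum (hf1 i) (hm i) (hf i).integrable_sq
  have hsq : ∀ i, ∫ x, f i x ^ 2 = 1 := fun i => by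
    have h := ho i i
    rw [if_pos rfl, setIntegral_eq_integral_of_forall_compl_eq_zero
      fun x hx => by rw [h0 i x hx, zero_mul]] at h
    simpa [sq] using h
  have hball1 := integrableOn_norm_rpow_ball hN (a := -(2 * s)) (by linarith) ρ
  have hball2 := integral_norm_rpow_ball hN (a := -(2 * s)) (by linarith) hρ0
  have hball3 := integral_norm_rpow_ball hN (a := 0) (by linarith) hρ0
  simp only [Real.rpow_zero, integral_const, smul_eq_mul, mul_one, add_zero,
    measureReal_restrict_apply_univ] at hball3
  have hconst : IntegrableOn (fun _ : EuclideanSpace ℝ (Fin N) => ρ ^ (-(2 * s)))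
      (Metric.ball 0 ρ) := integrableOn_const measure_ball_lt_top.ne
  have hind : Integrable ((Metric.ball (0 : EuclideanSpace ℝ (Fin N)) ρ).indicator
      fun w => ‖w‖ ^ (-(2 * s)) - ρ ^ (-(2 * s))) :=
    (integrable_indicator_iff measurableSet_ball).2 (hball1.sub hconst)
  -- The last constant is the integral of `|w|^(-2s) - ρ^(-2s)` over the ball: `ω ρ^(N-2s) (1/(N-2s)
  -- - 1/N)`. It is of order `s`, and its first-order coefficient is what produces `d_N`.
  have key : ∑ i, ∫ w, powerSpectrum (f i) w * ‖w‖ ^ (-(2 * s)) ≤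
      k * ρ ^ (-(2 * s)) + volume.real Ω *
        (sphereArea N * ρ ^ ((N : ℝ) - 2 * s) * (2 * s / (N * (N - 2 * s)))) := by
    have hpt : ∀ w ≠ 0, ∑ i, powerSpectrum (f i) w * ‖w‖ ^ (-(2 * s)) ≤
        (∑ i, powerSpectrum (f i) w) * ρ ^ (-(2 * s)) + volume.real Ω *
          (Metric.ball (0 : EuclideanSpace ℝ (Fin N)) ρ).indicator
            (fun w => ‖w‖ ^ (-(2 * s)) - ρ ^ (-(2 * s))) w := by
      intro w hw
      rw [← Finset.sum_mul]
      have hw' : 0 < ‖w‖ := norm_pos_iff.2 hw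
      have hF0 : 0 ≤ ∑ i, powerSpectrum (f i) w :=
        Finset.sum_nonneg fun i _ => powerSpectrum_nonneg _ _
      have hF1 := sum_powerSpectrum_le hfin hf h0 ho w
      -- Bathtub: write the weight as `ρ^(-2s)` plus an excess. The excess is nonnegative inside the
      -- ball, where the spectral sum is at most `|Ω|`, and nonpositive outside, where it is
      -- dropped.
      by_cases hwρ : ‖w‖ < ρ
      · rw [indicator_of_mem (by simpa using hwρ)]
        have := Real.rpow_le_rpow_of_nonpos hw' hwρ.le (by linarith : -(2 * s) ≤ 0)
        nlinarith
      · rw [indicator_of_notMem (by simpa using hwρ), mul_zero, add_zero]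
        exact mul_le_mul_of_nonneg_left
          (Real.rpow_le_rpow_of_nonpos hρ0 (not_lt.1 hwρ) (by linarith)) hF0
    have hsum : Integrable fun w => ∑ i, powerSpectrum (f i) w :=
      integrable_finsetSum _ fun i _ => hP i
    have hmass : ∫ w, ∑ i, powerSpectrum (f i) w ≤ k := by
      rw [integral_finsetSum _ fun i _ => hP i]
      refine (Finset.sum_le_card_nsmul _ _ 1 fun i _ => ?_).trans (by simp)
      exact (integral_powerSpectrum_le (hf1 i) (hm i) (hf i).integrable_sq).trans (hsq i).le
    rw [← integral_finsetSum _ fun i _ => hi i]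
    calc ∫ w, ∑ i, powerSpectrum (f i) w * ‖w‖ ^ (-(2 * s))
        ≤ ∫ w, ((∑ i, powerSpectrum (f i) w) * ρ ^ (-(2 * s)) + volume.real Ω *
          (Metric.ball (0 : EuclideanSpace ℝ (Fin N)) ρ).indicator
            (fun w => ‖w‖ ^ (-(2 * s)) - ρ ^ (-(2 * s))) w) :=
          integral_mono_ae (integrable_finsetSum _ fun i _ => hi i)
            ((hsum.mul_const _).add (hind.const_mul _))
            ((ae_ne_zero hN).mono fun w hw => hpt w hw)
      _ = (∫ w, ∑ i, powerSpectrum (f i) w) * ρ ^ (-(2 * s)) + volume.real Ω *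
          (sphereArea N * ρ ^ ((N : ℝ) - 2 * s) * (2 * s / (N * (N - 2 * s)))) := by
          rw [integral_add (hsum.mul_const _) (hind.const_mul _), integral_mul_const,
            integral_const_mul, integral_indicator measurableSet_ball,
            integral_sub hball1 hconst, hball2, setIntegral_const, hball3, smul_eq_mul]
          congr 2
          rw [← sub_eq_add_neg, sub_eq_add_neg (N : ℝ), Real.rpow_add hρ0, ← sub_eq_add_neg]
          have : (N : ℝ) - 2 * s ≠ 0 := by linarith
          field_simp
          ring
      _ ≤ _ := by gcongr
  simp only [rieszConst_mul_integral hN (hm _) (hf1 _) (hf _).integrable_sq hs hsN]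
  rw [← Finset.mul_sum]
  refine (mul_le_mul_of_nonneg_left key (by positivity)).trans (le_of_eq ?_)
  have h1 : ρ ^ (-(2 * s)) = R ^ (-(2 * s)) / (2 * π) ^ (-(2 * s)) :=
    Real.div_rpow hR.le (by positivity) _
  have h2 : ρ ^ ((N : ℝ) - 2 * s) =
      R ^ ((N : ℝ) - 2 * s) / ((2 * π) ^ N * (2 * π) ^ (-(2 * s))) := by
    rw [hρ, Real.div_rpow hR.le (by positivity), sub_eq_add_neg (N : ℝ) (2 * s),
      Real.rpow_add (by positivity) _ (-(2 * s)), Real.rpow_add (by positivity) _ (-(2 * s)),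
      Real.rpow_natCast, Real.rpow_natCast]
  rw [h1, h2]
  have : (N : ℝ) - 2 * s ≠ 0 := by linarith
  have h3 : (0 : ℝ) < (2 * π) ^ (-(2 * s)) := by positivity
  field_simp

end Riesz

/-! ### The limit `s → 0+`: from Riesz energies to the logarithmic form. -/

theorem measurableSet_nearPairs (N : ℕ) : MeasurableSet (nearPairs N) :=
  (isClosed_le continuous_dist continuous_const).measurableSet

theorem measurableSet_farPairs (N : ℕ) : MeasurableSet (farPairs N) :=
  (isClosed_le continuous_const continuous_dist).measurableSet

/-- Both sets contain the pairs at distance exactly one, which are null because spheres are. -/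
theorem farPairs_compl_ae_eq_nearPairs {N : ℕ} :
    ((farPairs N)ᶜ : Set (EuclideanSpace ℝ (Fin N) × EuclideanSpace ℝ (Fin N)))
      =ᵐ[volume] nearPairs N := by
  have h0 : ∀ᵐ x : EuclideanSpace ℝ (Fin N), ‖x‖ ≠ 1 := by
    rw [ae_iff]
    convert Measure.addHaar_sphere_of_ne_zero volume (0 : EuclideanSpace ℝ (Fin N)) one_ne_zero
      using 2
    ext x
    simp
  have h1 : ∀ᵐ p : EuclideanSpace ℝ (Fin N) × EuclideanSpace ℝ (Fin N), ‖p.1 - p.2‖ ≠ 1 :=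
    (quasiMeasurePreserving_sub_of_right_invariant volume volume).ae h0
  filter_upwards [h1] with p hp
  rw [← dist_eq_norm] at hp
  refine propext ⟨fun h => ?_, fun h => ?_⟩
  · have h' : ¬ 1 ≤ dist p.1 p.2 := h
    exact (not_le.1 h').le
  · have h' : dist p.1 p.2 ≤ 1 := h
    exact not_le.2 (lt_of_le_of_ne h' hp)

/-- The normalized ratio of the Riesz constant by its argument, continued to zero. -/
noncomputable def rieszRatio (N : ℕ) (s : ℝ) : ℝ :=
  Real.Gamma ((N : ℝ) / 2 - s) / (4 ^ s * Real.Gamma (1 + s)) / π ^ ((N : ℝ) / 2)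

theorem rieszConst_eq (N : ℕ) {s : ℝ} (hs : 0 < s) : rieszConst N s = s * rieszRatio N s := by
  have := Real.Gamma_pos_of_pos hs
  rw [rieszConst, rieszRatio, add_comm 1 s, Real.Gamma_add_one hs.ne']
  field_simp

/-- The function equals one at `s = 0`, so its derivative there is its logarithmic derivative:
`Γ(N/2-s)`, `4^s` and `Γ(1+s)` contribute `-ψ(N/2)`, `-2 ln 2` and `+γ`. This is the origin of
`ρ_N`. -/
theorem hasDerivAt_rieszRatio {N : ℕ} (hN : 1 ≤ N) :
    HasDerivAt (fun s => rieszRatio N s * sphereArea N / 2) (-rhoConst N) 0 := by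
  have hN' : (0 : ℝ) < N := by exact_mod_cast hN
  have hG : 0 < Real.Gamma ((N : ℝ) / 2) := Real.Gamma_pos_of_pos (by positivity)
  have hdiff : ∀ {x : ℝ}, 0 < x → HasDerivAt Real.Gamma (deriv Real.Gamma x) x := fun {x} hx =>
    (Real.differentiableAt_Gamma fun m hm => by
      have : (0 : ℝ) ≤ m := Nat.cast_nonneg m
      linarith).hasDerivAt
  have h1 : HasDerivAt (fun s : ℝ => Real.Gamma ((N : ℝ) / 2 - s))
      (-deriv Real.Gamma ((N : ℝ) / 2)) 0 := by
    have h := (hdiff (x := (N : ℝ) / 2 - 0) (by simpa using hN')).comp 0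
      ((hasDerivAt_id (0 : ℝ)).const_sub ((N : ℝ) / 2))
    simpa [Function.comp_def] using h
  have h2 : HasDerivAt (fun s : ℝ => (4 : ℝ) ^ s) (Real.log 4) 0 := by
    simpa using (hasDerivAt_id (0 : ℝ)).const_rpow (a := 4) (by norm_num)
  have h3 : HasDerivAt (fun s : ℝ => Real.Gamma (1 + s)) (-Real.eulerMascheroniConstant) 0 := by
    have h := (hdiff (x := 1 + 0) (by norm_num)).comp 0 ((hasDerivAt_id (0 : ℝ)).const_add 1)
    rw [Real.eulerMascheroniConstant_eq_neg_deriv, neg_neg]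
    simpa [Function.comp_def] using h
  have h4 := (((h1.div (h2.mul h3) (by simp)).div_const (π ^ ((N : ℝ) / 2))).mul_const
    (sphereArea N)).div_const 2
  refine h4.congr_deriv ?_
  have hP : 0 < π ^ ((N : ℝ) / 2) := by positivity
  have hl : Real.log 4 = 2 * Real.log 2 := by
    rw [show (4 : ℝ) = 2 ^ 2 by norm_num, Real.log_pow]
    norm_num
  simp only [Pi.mul_apply, Real.rpow_zero, add_zero, Real.Gamma_one, mul_one, sub_zero, one_mul,
    sphereArea_eq hN, rhoConst, logDeriv_apply, hl]
  field_simp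
  ring

theorem rieszRatio_zero_mul {N : ℕ} (hN : 1 ≤ N) :
    rieszRatio N 0 * sphereArea N / 2 = 1 := by
  have hN' : (0 : ℝ) < N := by exact_mod_cast hN
  have hG : 0 < Real.Gamma ((N : ℝ) / 2) := Real.Gamma_pos_of_pos (by positivity)
  have hP : 0 < π ^ ((N : ℝ) / 2) := by positivity
  rw [rieszRatio, sphereArea_eq hN]
  simp only [sub_zero, Real.rpow_zero, add_zero, Real.Gamma_one, mul_one, div_one]
  field_simp

theorem tendsto_rieszRatio {N : ℕ} (hN : 1 ≤ N) :
    Tendsto (rieszRatio N) (𝓝[>] 0) (𝓝 (cConst N)) := by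
  have hω := sphereArea_pos hN
  have h := ((hasDerivAt_rieszRatio hN).continuousAt.tendsto.mono_left
    (nhdsWithin_le_nhds (s := Ioi 0))).mul_const (2 / sphereArea N)
  have hz : rieszRatio N 0 = cConst N := by
    simp only [rieszRatio, sub_zero, Real.rpow_zero, add_zero, Real.Gamma_one, mul_one, div_one,
      cConst, Real.rpow_neg pi_nonneg]
    field_simp
  rw [hz] at h
  convert h using 2
  · field_simp
  · field_simp

theorem tendsto_one_sub_rieszRatio {N : ℕ} (hN : 1 ≤ N) :
    Tendsto (fun s => (1 - rieszRatio N s * sphereArea N / 2) / s) (𝓝[>] 0)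
      (𝓝 (rhoConst N)) := by
  have h := ((hasDerivAt_iff_tendsto_slope_zero.1 (hasDerivAt_rieszRatio hN)).mono_left
    (nhdsWithin_mono 0 fun x (hx : 0 < x) => hx.ne')).neg
  rw [neg_neg] at h
  refine h.congr fun s => ?_
  rw [zero_add, rieszRatio_zero_mul hN, smul_eq_mul]
  ring

section Limit

variable {N : ℕ} {u : EuclideanSpace ℝ (Fin N) → ℝ}

/-- For `|x-y| ≤ 1` and `s > 0` the integrand is dominated by its value at `s = 0`, integrable by
`MemH`; on the diagonal the numerator vanishes. -/
theorem tendsto_integral_nearPairs {Ω : Set (EuclideanSpace ℝ (Fin N))} (hu : MemH Ω u) :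
    Tendsto (fun s : ℝ => ∫ p in nearPairs N, (u p.1 - u p.2) ^ 2 * ‖p.1 - p.2‖ ^ (2 * s - N))
      (𝓝[>] 0) (𝓝 (∫ p in nearPairs N, (u p.1 - u p.2) * (u p.1 - u p.2) / dist p.1 p.2 ^ N)) := by
  have hum := hu.measurable
  refine tendsto_integral_filter_of_dominated_convergence _ ?_ ?_ hu.integrableOn ?_
  · exact Eventually.of_forall fun s => Measurable.aestronglyMeasurable (by fun_prop)
  · filter_upwards [self_mem_nhdsWithin] with s hs
    have hs : 0 < s := hs
    filter_upwards [ae_restrict_mem (measurableSet_nearPairs N)] with p hp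
    have hp : dist p.1 p.2 ≤ 1 := hp
    rw [Real.norm_of_nonneg (by positivity), ← dist_eq_norm]
    rcases eq_or_lt_of_le (dist_nonneg (x := p.1) (y := p.2)) with h0 | h0
    · rw [dist_eq_zero.1 h0.symm]
      simp
    · rw [div_eq_mul_inv, ← Real.rpow_natCast _ N, ← Real.rpow_neg h0.le]
      exact mul_le_mul_of_nonneg_left
        (Real.rpow_le_rpow_of_exponent_ge h0 hp (by linarith)) (sq_nonneg _)
  · refine ae_of_all _ fun p => ?_
    rcases eq_or_lt_of_le (dist_nonneg (x := p.1) (y := p.2)) with h0 | h0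
    · rw [dist_eq_zero.1 h0.symm]
      simp
    · have h1 : Tendsto (fun s : ℝ => 2 * s - (N : ℝ)) (𝓝[>] 0) (𝓝 (-(N : ℝ))) := by
        have : Continuous fun s : ℝ => 2 * s - (N : ℝ) := by fun_prop
        simpa using (this.tendsto 0).mono_left nhdsWithin_le_nhds
      have h2 := ((Real.continuousAt_const_rpow h0.ne').tendsto.comp h1).const_mul
        ((u p.1 - u p.2) ^ 2)
      simpa [Function.comp_def, dist_eq_norm, Real.rpow_neg, div_eq_mul_inv, sq] using h2

theorem tendsto_integral_farPairs (hN : 1 ≤ N) (hum : Measurable u) (hu1 : Integrable u) :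
    Tendsto (fun s : ℝ => ∫ p in farPairs N, u p.1 * u p.2 * ‖p.1 - p.2‖ ^ (2 * s - N))
      (𝓝[>] 0) (𝓝 (∫ p in farPairs N, u p.1 * u p.2 / dist p.1 p.2 ^ N)) := by
  have hN' : (0 : ℝ) < N := by exact_mod_cast hN
  have hi : Integrable fun p : EuclideanSpace ℝ (Fin N) × EuclideanSpace ℝ (Fin N) =>
    u p.1 * u p.2 := hu1.mul_prod hu1
  refine tendsto_integral_filter_of_dominated_convergence _ ?_ ?_ hi.norm.integrableOn ?_
  · exact Eventually.of_forall fun s => Measurable.aestronglyMeasurable (by fun_prop)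
  · filter_upwards [Ioo_mem_nhdsGT (show (0 : ℝ) < N / 2 by positivity)] with s hs
    filter_upwards [ae_restrict_mem (measurableSet_farPairs N)] with p hp
    have hp : 1 ≤ dist p.1 p.2 := hp
    rw [norm_mul, Real.norm_of_nonneg (by positivity : 0 ≤ ‖p.1 - p.2‖ ^ (2 * s - N)),
      ← dist_eq_norm]
    exact mul_le_of_le_one_right (norm_nonneg _)
      (Real.rpow_le_one_of_one_le_of_nonpos hp (by linarith [hs.2]))
  · filter_upwards [ae_restrict_mem (measurableSet_farPairs N)] with p hp
    have hp : 1 ≤ dist p.1 p.2 := hp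
    have h0 : 0 < dist p.1 p.2 := by linarith
    have h1 : Tendsto (fun s : ℝ => 2 * s - (N : ℝ)) (𝓝[>] 0) (𝓝 (-(N : ℝ))) := by
      have : Continuous fun s : ℝ => 2 * s - (N : ℝ) := by fun_prop
      simpa using (this.tendsto 0).mono_left nhdsWithin_le_nhds
    have h2 := ((Real.continuousAt_const_rpow h0.ne').tendsto.comp h1).const_mul (u p.1 * u p.2)
    simpa [Function.comp_def, dist_eq_norm, Real.rpow_neg, div_eq_mul_inv] using h2

/-- Only the near part is rewritten through squared differences, using the Riesz kernel truncated to
the unit ball, of mass `ω/(2s)`. -/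
theorem integral_mul_mul_norm_sub_rpow (hN : 1 ≤ N) (hum : Measurable u) (hu1 : Integrable u)
    (hu2 : Integrable fun x => u x ^ 2) {s : ℝ} (hs : 0 < s) (hsN : 2 * s < N) :
    ∫ p : EuclideanSpace ℝ (Fin N) × EuclideanSpace ℝ (Fin N),
        u p.1 * u p.2 * ‖p.1 - p.2‖ ^ (2 * s - N) =
      (∫ x, u x ^ 2) * (sphereArea N / (2 * s)) -
        (∫ p in nearPairs N, (u p.1 - u p.2) ^ 2 * ‖p.1 - p.2‖ ^ (2 * s - N)) / 2 +
        ∫ p in farPairs N, u p.1 * u p.2 * ‖p.1 - p.2‖ ^ (2 * s - N) := by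
  have hg : Integrable ((Metric.ball (0 : EuclideanSpace ℝ (Fin N)) 1).indicator
      fun y => ‖y‖ ^ (2 * s - (N : ℝ))) := (integrable_indicator_iff measurableSet_ball).2
    (integrableOn_norm_rpow_ball hN (by linarith) 1)
  have hg1 : ∫ y, (Metric.ball (0 : EuclideanSpace ℝ (Fin N)) 1).indicator
      (fun y => ‖y‖ ^ (2 * s - (N : ℝ))) y = sphereArea N / (2 * s) := by
    rw [integral_indicator measurableSet_ball, integral_norm_rpow_ball hN (by linarith) one_pos,
      Real.one_rpow, mul_one, add_sub_cancel]
  have hkey := integral_mul_mul_comp_sub hum hu2 hg (indicator_ball_neg _)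
  have hind : ∀ (F : EuclideanSpace ℝ (Fin N) × EuclideanSpace ℝ (Fin N) → ℝ) (p),
      F p * (Metric.ball (0 : EuclideanSpace ℝ (Fin N)) 1).indicator
        (fun y => ‖y‖ ^ (2 * s - (N : ℝ))) (p.1 - p.2) =
      (farPairs N)ᶜ.indicator (fun p => F p * ‖p.1 - p.2‖ ^ (2 * s - (N : ℝ))) p := by
    intro F p
    by_cases hp : dist p.1 p.2 < 1
    · rw [indicator_of_mem (by simpa [dist_eq_norm] using hp),
        indicator_of_mem (show p ∈ (farPairs N)ᶜ from not_le.2 hp)]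
    · rw [indicator_of_notMem (by simpa [dist_eq_norm] using hp),
        indicator_of_notMem (show p ∉ (farPairs N)ᶜ from not_not.2 (not_lt.1 hp)), mul_zero]
  rw [hg1] at hkey
  simp only [hind (fun p => u p.1 * u p.2), hind (fun p => (u p.1 - u p.2) ^ 2),
    integral_indicator (measurableSet_farPairs N).compl] at hkey
  rw [setIntegral_congr_set farPairs_compl_ae_eq_nearPairs
    (f := fun p => (u p.1 - u p.2) ^ 2 * ‖p.1 - p.2‖ ^ (2 * s - (N : ℝ)))] at hkey
  rw [← hkey, add_comm]
  exact (integral_add_compl (measurableSet_farPairs N)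
    (integrable_mul_mul_norm_sub_rpow hN hum hu1 hu2 (by linarith) (by linarith))).symm

/-- As `rieszConst = s * rieszRatio`, the singular mass `ω/(2s)` contributes `rieszRatio * ω/2 → 1`
and cancels the norm; the remainder over `s` tends to `ρ_N`. The near and far integrals appear with
the factor `rieszRatio → c_N`. -/
theorem tendsto_formL {Ω : Set (EuclideanSpace ℝ (Fin N))} (hN : 1 ≤ N) (hu : MemH Ω u)
    (hu1 : Integrable u) (hu2 : Integrable fun x => u x ^ 2) :
    Tendsto (fun s : ℝ => ((∫ x, u x ^ 2) -
      rieszConst N s * ∫ p : EuclideanSpace ℝ (Fin N) × EuclideanSpace ℝ (Fin N),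
        u p.1 * u p.2 * ‖p.1 - p.2‖ ^ (2 * s - N)) / s) (𝓝[>] 0) (𝓝 (formL u u)) := by
  have hN' : (0 : ℝ) < N := by exact_mod_cast hN
  have h1 := tendsto_rieszRatio hN
  have h := (((h1.div_const 2).mul (tendsto_integral_nearPairs hu)).sub
    (h1.mul (tendsto_integral_farPairs hN hu.measurable hu1))).add
    ((tendsto_one_sub_rieszRatio hN).mul_const (∫ x, u x * u x))
  refine h.congr' ?_
  filter_upwards [Ioo_mem_nhdsGT (show (0 : ℝ) < N / 2 by positivity)] with s hs
  have hs0 : 0 < s := hs.1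
  rw [integral_mul_mul_norm_sub_rpow hN hu.measurable hu1 hu2 hs0 (by linarith [hs.2]),
    rieszConst_eq N hs0]
  simp only [← sq]
  field_simp
  ring

/-- Divide the bathtub estimate by `s` and let `s → 0`; `(1 - R^(-2s))/s` tends to `2 ln R`. -/
theorem sum_formL_ge (hN : 1 ≤ N) {k : ℕ}
    {Ω : Set (EuclideanSpace ℝ (Fin N))} (hfin : volume Ω ≠ ⊤)
    {f : Fin k → EuclideanSpace ℝ (Fin N) → ℝ} (hH : ∀ i, MemH Ω (f i))
    (hf1 : ∀ i, Integrable (f i)) (hf : ∀ i, MemLp (f i) 2 volume)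
    (ho : ∀ i j, ∫ x in Ω, f i x * f j x = if i = j then 1 else 0) {R : ℝ} (hR : 0 < R) :
    2 * k * Real.log R - dConst N * volume.real Ω * R ^ N ≤ ∑ i, formL (f i) (f i) := by
  have hN' : (0 : ℝ) < N := by exact_mod_cast hN
  have hsq : ∀ i, ∫ x, f i x ^ 2 = 1 := fun i => by
    have h := ho i i
    rw [if_pos rfl, setIntegral_eq_integral_of_forall_compl_eq_zero
      fun x hx => by rw [(hH i).eq_zero x hx, zero_mul]] at h
    simpa [sq] using h
  have hlim := tendsto_finsetSum Finset.univ fun i _ =>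
    tendsto_formL hN (hH i) (hf1 i) (hf i).integrable_sq
  have hlow : Tendsto (fun s => (k : ℝ) * ((1 - R ^ (-(2 * s))) / s) -
      volume.real Ω * (sphereArea N * R ^ ((N : ℝ) - 2 * s) *
        (2 / (N * (N - 2 * s))) / (2 * π) ^ N)) (𝓝[>] 0)
      (𝓝 (2 * k * Real.log R - dConst N * volume.real Ω * R ^ N)) := by
    have hd : HasDerivAt (fun s : ℝ => R ^ (-(2 * s))) (-(2 * Real.log R)) 0 := by
      have h := (((hasDerivAt_id (0 : ℝ)).const_mul 2).neg).const_rpow (a := R) hR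
      simp only [id, Pi.neg_apply, mul_zero, neg_zero, Real.rpow_zero] at h
      exact h.congr_deriv (by ring)
    have h1 : Tendsto (fun s => (1 - R ^ (-(2 * s))) / s) (𝓝[>] 0) (𝓝 (2 * Real.log R)) := by
      have h := ((hasDerivAt_iff_tendsto_slope_zero.1 hd).mono_left
        (nhdsWithin_mono 0 fun x (hx : 0 < x) => hx.ne')).neg
      rw [neg_neg] at h
      refine h.congr fun s => ?_
      simp only [zero_add, mul_zero, neg_zero, Real.rpow_zero, smul_eq_mul]
      ring
    have h2 : Tendsto (fun s => volume.real Ω * (sphereArea N * R ^ ((N : ℝ) - 2 * s) *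
        (2 / (N * (N - 2 * s))) / (2 * π) ^ N)) (𝓝[>] 0)
        (𝓝 (volume.real Ω * (sphereArea N * R ^ ((N : ℝ) - 2 * 0) *
        (2 / (N * (N - 2 * 0))) / (2 * π) ^ N))) := by
      refine Tendsto.mono_left (ContinuousAt.tendsto (f := fun s : ℝ => volume.real Ω *
        (sphereArea N * R ^ ((N : ℝ) - 2 * s) * (2 / (N * (N - 2 * s))) / (2 * π) ^ N)) ?_)
        nhdsWithin_le_nhds
      have hc1 : ContinuousAt (fun s : ℝ => R ^ ((N : ℝ) - 2 * s)) 0 :=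
        ContinuousAt.rpow continuousAt_const (by fun_prop) (Or.inl hR.ne')
      have hc2 : ContinuousAt (fun s : ℝ => 2 / ((N : ℝ) * (N - 2 * s))) 0 :=
        ContinuousAt.div continuousAt_const (by fun_prop) (by simp; lia)
      exact (((continuousAt_const.mul hc1).mul hc2).div_const _).const_mul _
    convert (h1.const_mul (k : ℝ)).sub h2 using 2
    rw [dConst, mul_zero, sub_zero, Real.rpow_natCast]
    field_simp
  refine le_of_tendsto_of_tendsto hlow hlim ?_
  filter_upwards [Ioo_mem_nhdsGT (show (0 : ℝ) < N / 2 by positivity)] with s hs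
  have hs0 : 0 < s := hs.1
  have h := sum_rieszConst_mul_integral_le hN hfin (fun i => (hH i).measurable) hf1 hf
    (fun i => (hH i).eq_zero) ho hs0 (by linarith [hs.2]) hR
  simp only [hsq]
  rw [← Finset.sum_div, Finset.sum_sub_distrib, le_div_iff₀ hs0]
  simp only [Finset.sum_const, Finset.card_univ, Fintype.card_fin, nsmul_eq_mul, mul_one]
  refine le_trans (le_of_eq ?_) (sub_le_sub_left h _)
  have : (N : ℝ) - 2 * s ≠ 0 := by linarith [hs.2]
  field_simp
  ring

end Limit

/-! ### Linearity of the form on `ℍ(Ω)`. -/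

section Linear

variable {N : ℕ} {Ω : Set (EuclideanSpace ℝ (Fin N))} {u v : EuclideanSpace ℝ (Fin N) → ℝ}

/-- The integral of a non-integrable function is zero by default, so normalization to one already
forces square integrability. -/
theorem MemH.memLp_two (hu : MemH Ω u) (h : ∫ x in Ω, u x * u x = 1) : MemLp u 2 volume := by
  have h1 : ∀ x ∉ Ω, u x * u x = 0 := fun x hx => by rw [hu.eq_zero x hx, zero_mul]
  rw [setIntegral_eq_integral_of_forall_compl_eq_zero h1] at h
  rw [memLp_two_iff_integrable_sq hu.measurable.aestronglyMeasurable]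
  simp only [sq]
  by_contra hc
  rw [integral_undef hc] at h
  exact zero_ne_one h

theorem MemH.integrable (hfin : volume Ω ≠ ⊤) (hu : MemH Ω u) (h : MemLp u 2 volume) :
    Integrable u := by
  have : IsFiniteMeasure (volume.restrict Ω) := ⟨by simpa using hfin.lt_top⟩
  have h1 : IntegrableOn u Ω := (h.restrict Ω).integrable one_le_two
  refine (integrableOn_iff_integrable_of_support_subset fun x hx => ?_).1 h1
  by_contra hc
  exact hx (hu.eq_zero x hc)

theorem MemH.integrableOn_mul (hu : MemH Ω u) (hv : MemH Ω v) :
    IntegrableOn (fun p : EuclideanSpace ℝ (Fin N) × EuclideanSpace ℝ (Fin N) =>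
      (u p.1 - u p.2) * (v p.1 - v p.2) / dist p.1 p.2 ^ N) (nearPairs N) := by
  have hum := hu.measurable
  have hvm := hv.measurable
  refine (hu.integrableOn.add hv.integrableOn).mono'
    (Measurable.aestronglyMeasurable (by fun_prop)) (ae_of_all _ fun p => ?_)
  rw [Pi.add_apply, norm_div, Real.norm_of_nonneg (by positivity : 0 ≤ dist p.1 p.2 ^ N),
    ← add_div, Real.norm_eq_abs, abs_mul, ← sq_abs (u p.1 - u p.2), ← sq_abs (v p.1 - v p.2)]
  gcongr
  nlinarith [sq_nonneg (|u p.1 - u p.2| - |v p.1 - v p.2|), sq_nonneg |u p.1 - u p.2|,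
    sq_nonneg |v p.1 - v p.2|]

theorem integrableOn_farPairs (hum : Measurable u) (hvm : Measurable v) (hu : Integrable u)
    (hv : Integrable v) :
    IntegrableOn (fun p : EuclideanSpace ℝ (Fin N) × EuclideanSpace ℝ (Fin N) =>
      u p.1 * v p.2 / dist p.1 p.2 ^ N) (farPairs N) := by
  have hi : Integrable fun p : EuclideanSpace ℝ (Fin N) × EuclideanSpace ℝ (Fin N) =>
    u p.1 * v p.2 := hu.mul_prod hv
  refine hi.norm.integrableOn.mono' (Measurable.aestronglyMeasurable (by fun_prop)) ?_
  filter_upwards [ae_restrict_mem (measurableSet_farPairs N)] with p hp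
  have hp : 1 ≤ dist p.1 p.2 := hp
  rw [norm_div, Real.norm_of_nonneg (by positivity : 0 ≤ dist p.1 p.2 ^ N)]
  exact div_le_self (norm_nonneg _) (one_le_pow₀ hp)

theorem MemH.add (hu : MemH Ω u) (hv : MemH Ω v) : MemH Ω fun x => u x + v x where
  measurable := hu.measurable.add hv.measurable
  eq_zero x hx := by rw [hu.eq_zero x hx, hv.eq_zero x hx, add_zero]
  integrableOn := by
    refine ((hu.integrableOn.add hv.integrableOn).add
      ((hu.integrableOn_mul hv).const_mul 2)).congr (ae_of_all _ fun p => ?_)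
    simp only [Pi.add_apply]
    ring

theorem MemH.const_mul (hu : MemH Ω u) (c : ℝ) : MemH Ω fun x => c * u x where
  measurable := hu.measurable.const_mul c
  eq_zero x hx := by rw [hu.eq_zero x hx, mul_zero]
  integrableOn := by
    refine (hu.integrableOn.const_mul (c ^ 2)).congr (ae_of_all _ fun p => ?_)
    simp only
    ring

theorem memH_zero : MemH Ω fun _ : EuclideanSpace ℝ (Fin N) => 0 where
  measurable := measurable_const
  eq_zero _ _ := rfl
  integrableOn := by simp

theorem memH_sum {ι : Type*} (s : Finset ι) {φ : ι → EuclideanSpace ℝ (Fin N) → ℝ}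
    (hφ : ∀ i, MemH Ω (φ i)) (c : ι → ℝ) : MemH Ω fun x => ∑ i ∈ s, c i * φ i x := by
  classical
  induction s using Finset.induction_on with
  | empty => simpa using memH_zero
  | insert a s ha ih =>
    simp only [Finset.sum_insert ha]
    exact ((hφ a).const_mul (c a)).add ih

theorem setIntegral_sum_mul {ι : Type*} (s : Finset ι)
    {φ : ι → EuclideanSpace ℝ (Fin N) → ℝ}
    (hφ2 : ∀ i, MemLp (φ i) 2 volume) (hv2 : MemLp v 2 volume) (c : ι → ℝ) :
    ∫ x in Ω, (∑ i ∈ s, c i * φ i x) * v x = ∑ i ∈ s, c i * ∫ x in Ω, φ i x * v x := by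
  have hi : ∀ i, IntegrableOn (fun x => φ i x * v x) Ω := fun i =>
    ((hφ2 i).integrable_mul hv2).integrableOn
  simp only [← integral_const_mul]
  rw [← integral_finsetSum _ fun i _ => (hi i).const_mul (c i)]
  refine integral_congr_ae (ae_of_all _ fun x => ?_)
  simp only [Finset.sum_mul]
  exact Finset.sum_congr rfl fun i _ => by ring

theorem formL_sum_left {ι : Type*} (s : Finset ι) (hfin : volume Ω ≠ ⊤)
    {φ : ι → EuclideanSpace ℝ (Fin N) → ℝ} (hφ : ∀ i, MemH Ω (φ i))
    (hφ2 : ∀ i, MemLp (φ i) 2 volume) (hv : MemH Ω v) (hv2 : MemLp v 2 volume) (c : ι → ℝ) :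
    formL (fun x => ∑ i ∈ s, c i * φ i x) v = ∑ i ∈ s, c i * formL (φ i) v := by
  have h1 : ∫ p in nearPairs N, ((∑ i ∈ s, c i * φ i p.1) - ∑ i ∈ s, c i * φ i p.2) *
      (v p.1 - v p.2) / dist p.1 p.2 ^ N = ∑ i ∈ s, c i * ∫ p in nearPairs N,
        (φ i p.1 - φ i p.2) * (v p.1 - v p.2) / dist p.1 p.2 ^ N := by
    simp only [← integral_const_mul]
    rw [← integral_finsetSum _ fun i _ => ((hφ i).integrableOn_mul hv).const_mul (c i)]
    refine integral_congr_ae (ae_of_all _ fun p => ?_)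
    simp only [← Finset.sum_sub_distrib, Finset.sum_mul, Finset.sum_div]
    exact Finset.sum_congr rfl fun i _ => by ring
  have h2 : ∫ p in farPairs N, (∑ i ∈ s, c i * φ i p.1) * v p.2 / dist p.1 p.2 ^ N =
      ∑ i ∈ s, c i * ∫ p in farPairs N, φ i p.1 * v p.2 / dist p.1 p.2 ^ N := by
    simp only [← integral_const_mul]
    rw [← integral_finsetSum _ fun i _ => (integrableOn_farPairs (hφ i).measurable hv.measurable
      ((hφ i).integrable hfin (hφ2 i)) (hv.integrable hfin hv2)).const_mul (c i)]
    refine integral_congr_ae (ae_of_all _ fun p => ?_)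
    simp only [Finset.sum_mul, Finset.sum_div]
    exact Finset.sum_congr rfl fun i _ => by ring
  have h3 : ∫ x, (∑ i ∈ s, c i * φ i x) * v x = ∑ i ∈ s, c i * ∫ x, φ i x * v x := by
    simpa using setIntegral_sum_mul (Ω := univ) s hφ2 hv2 c
  simp only [formL, energy]
  rw [h1, h2, h3, Finset.mul_sum, Finset.mul_sum, Finset.mul_sum, ← Finset.sum_sub_distrib,
    ← Finset.sum_add_distrib]
  exact Finset.sum_congr rfl fun i _ => by ring

end Linear

/-! ### Orthonormal trial functions extracted from the eigenvalue counts. -/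

section Selection

variable {N : ℕ} {Ω : Set (EuclideanSpace ℝ (Fin N))}

/-- `m` homogeneous linear equations in `m + 1` unknowns have a nonzero solution, which is then
normalized. -/
theorem exists_sum_sq_eq_one_and_orthogonal {m : ℕ} (M : Fin m → Fin (m + 1) → ℝ) :
    ∃ c : Fin (m + 1) → ℝ, ∑ j, c j ^ 2 = 1 ∧ ∀ l, ∑ j, c j * M l j = 0 := by
  have hker := LinearMap.ker_ne_bot_of_finrank_lt (f := Matrix.mulVecLin (Matrix.of M))
    (by simp)
  obtain ⟨d, hd, hd0⟩ := (Submodule.ne_bot_iff _).1 hker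
  have hpos : 0 < ∑ j, d j ^ 2 := by
    obtain ⟨j, hj⟩ := Function.ne_iff.1 hd0
    have hj : d j ≠ 0 := hj
    exact Finset.sum_pos' (fun i _ => sq_nonneg _) ⟨j, Finset.mem_univ j, by positivity⟩
  refine ⟨fun j => d j / √(∑ j, d j ^ 2), ?_, fun l => ?_⟩
  · simp only [div_pow, Real.sq_sqrt hpos.le]
    rw [← Finset.sum_div, div_self hpos.ne']
  · have h := congrFun (LinearMap.mem_ker.1 hd) l
    simp only [Matrix.mulVecLin_apply, Matrix.mulVec, dotProduct, Matrix.of_apply,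
      Pi.zero_apply] at h
    simp only [div_mul_eq_mul_div]
    rw [← Finset.sum_div, div_eq_zero_iff]
    left
    rw [← h]
    exact Finset.sum_congr rfl fun j _ => mul_comm _ _

/-- Among `m + 1` eigenvalues not exceeding `t` there is room for a normalized function which is
orthogonal to `m` given ones and whose form is at most `t`. -/
theorem HasEigenvaluesUpTo.exists_orthogonal (hfin : volume Ω ≠ ⊤) {m : ℕ} {t : ℝ}
    (h : HasEigenvaluesUpTo Ω (m + 1) t) {ψ : Fin m → EuclideanSpace ℝ (Fin N) → ℝ}
    (hψ : ∀ l, MemLp (ψ l) 2 volume) :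
    ∃ g, MemH Ω g ∧ MemLp g 2 volume ∧ formL g g ≤ t ∧ ∫ x in Ω, g x * g x = 1 ∧
      ∀ l, ∫ x in Ω, g x * ψ l x = 0 := by
  obtain ⟨μ, φ, hφ, ho⟩ := h
  have hH : ∀ i, MemH Ω (φ i) := fun i => (hφ i).1.memH
  have h2 : ∀ i, MemLp (φ i) 2 volume := fun i => (hH i).memLp_two (by simpa using ho i i)
  obtain ⟨c, hc1, hc2⟩ := exists_sum_sq_eq_one_and_orthogonal
    fun l j => ∫ x in Ω, φ j x * ψ l x
  have hg := memH_sum Finset.univ hH c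
  have hg2 : MemLp (fun x => ∑ i, c i * φ i x) 2 volume :=
    memLp_finsetSum _ fun i _ => (h2 i).const_mul (c i)
  have hgφ : ∀ j, ∫ x in Ω, φ j x * ∑ i, c i * φ i x = c j := fun j => by
    simp only [mul_comm (φ j _)]
    rw [setIntegral_sum_mul _ h2 (h2 j)]
    simp [ho]
  refine ⟨_, hg, hg2, ?_, ?_, fun l => ?_⟩
  -- Testing each weak equation with the combination `g` itself gives `formL g g = ∑ μ_j c_j²`, so
  -- linearity in the first argument is enough.
  · rw [formL_sum_left _ hfin hH h2 hg hg2, ← mul_one t, ← hc1, Finset.mul_sum]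
    refine Finset.sum_le_sum fun j _ => ?_
    rw [(hφ j).1.weak_eq _ hg, hgφ]
    nlinarith [(hφ j).2, sq_nonneg (c j)]
  · rw [setIntegral_sum_mul _ h2 hg2, ← hc1]
    simp only [hgφ, sq]
  · rw [setIntegral_sum_mul _ h2 (hψ l)]
    exact hc2 l

/-- The families witnessing different `t i` need not be related, so the functions are picked one at
a time, each orthogonal to those already chosen. -/
theorem exists_orthonormal_formL_le (hfin : volume Ω ≠ ⊤) {t : ℕ → ℝ} (k : ℕ)
    (h : ∀ i < k, HasEigenvaluesUpTo Ω (i + 1) (t i)) :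
    ∃ f : ℕ → EuclideanSpace ℝ (Fin N) → ℝ,
      (∀ i < k, MemH Ω (f i) ∧ MemLp (f i) 2 volume ∧ formL (f i) (f i) ≤ t i) ∧
      ∀ i < k, ∀ j < k, ∫ x in Ω, f i x * f j x = if i = j then 1 else 0 := by
  induction k with
  | zero => exact ⟨fun _ _ => 0, by simp, by simp⟩
  | succ k ih =>
    obtain ⟨f, hf, ho⟩ := ih fun i hi => h i (by lia)
    obtain ⟨g, hg, hg2, hgt, hgg, hgf⟩ := (h k (by lia)).exists_orthogonal hfin
      (ψ := fun l => f l) (fun l => (hf l l.2).2.1)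
    refine ⟨fun i => if i = k then g else f i, fun i hi => ?_, fun i hi j hj => ?_⟩
    · by_cases hik : i = k
      · subst hik
        simpa using ⟨hg, hg2, hgt⟩
      · simpa [hik] using hf i (by lia)
    · by_cases hik : i = k <;> by_cases hjk : j = k
      · simp [hik, hjk, hgg]
      · simpa [hik, hjk, Ne.symm hjk] using hgf ⟨j, by lia⟩
      · simpa [hik, hjk, mul_comm] using hgf ⟨i, by lia⟩
      · simpa [hik, hjk] using ho i (by lia) j (by lia)

theorem sum_ge_of_hasEigenvaluesUpTo (hN : 1 ≤ N) (hfin : volume Ω ≠ ⊤) {t : ℕ → ℝ} {k : ℕ}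
    (h : ∀ i < k, HasEigenvaluesUpTo Ω (i + 1) (t i)) {R : ℝ} (hR : 0 < R) :
    2 * k * Real.log R - dConst N * volume.real Ω * R ^ N ≤ ∑ i ∈ Finset.range k, t i := by
  obtain ⟨f, hf, ho⟩ := exists_orthonormal_formL_le hfin k h
  refine (sum_formL_ge hN hfin (f := fun i : Fin k => f i) (fun i => (hf i i.2).1)
    (fun i => (hf i i.2).1.integrable hfin (hf i i.2).2.1) (fun i => (hf i i.2).2.1)
    (fun i j => by simpa [Fin.ext_iff] using ho i i.2 j j.2) hR).trans ?_
  rw [← Fin.sum_univ_eq_sum_range]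
  exact Finset.sum_le_sum fun i _ => (hf i i.2).2.2

theorem HasEigenvaluesUpTo.of_le {k m : ℕ} (hm : m ≤ k) {t : ℝ}
    (h : HasEigenvaluesUpTo Ω k t) : HasEigenvaluesUpTo Ω m t := by
  obtain ⟨μ, φ, hφ, ho⟩ := h
  refine ⟨fun i => μ (i.castLE hm), fun i => φ (i.castLE hm), fun i => hφ _, fun i j => ?_⟩
  simpa [Fin.ext_iff] using ho (i.castLE hm) (j.castLE hm)

/-- With `R = 1` and all `t i` equal to `t`, the sum bound reads `(k+1) t ≥ -d_N |Ω|`. -/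
theorem eigenvalue_ne_bot (hN : 1 ≤ N) (hfin : volume Ω ≠ ⊤) (k : ℕ) :
    eigenvalue Ω (k + 1) ≠ ⊥ := by
  refine ne_of_gt (lt_of_lt_of_le (EReal.bot_lt_coe
    (-(dConst N * volume.real Ω) / ((k : ℝ) + 1))) (le_sInf ?_))
  rintro _ ⟨t, ht, rfl⟩
  have h := sum_ge_of_hasEigenvaluesUpTo hN hfin (t := fun _ => t) (k := k + 1)
    (fun i hi => HasEigenvaluesUpTo.of_le (by lia) ht) one_pos
  simp only [Real.log_one, mul_zero, one_pow, mul_one, zero_sub, Finset.sum_const,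
    Finset.card_range, nsmul_eq_mul] at h
  rw [EReal.coe_le_coe_iff, div_le_iff₀ (by positivity)]
  push_cast at h
  linarith

theorem exists_lt_of_eigenvalue_lt {k : ℕ} {r : ℝ} (h : eigenvalue Ω k < r) :
    ∃ t < r, HasEigenvaluesUpTo Ω k t := by
  obtain ⟨_, ⟨t, ht, rfl⟩, htr⟩ := sInf_lt_iff.1 h
  exact ⟨t, EReal.coe_lt_coe_iff.1 htr, ht⟩

end Selection

/-! ### Sums of extended-real eigenvalues and the choice of `R`. -/

/-- Excluding `⊥` is essential, since `⊤ + ⊥ = ⊥` in `EReal`. -/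
theorem EReal_sum_eq_top {ι : Type*} (s : Finset ι) {e : ι → EReal} (hb : ∀ i ∈ s, e i ≠ ⊥)
    {i : ι} (hi : i ∈ s) (ht : e i = ⊤) : ∑ i ∈ s, e i = ⊤ := by
  classical
  have hsum : ∀ s' ⊆ s, ∑ i ∈ s', e i ≠ ⊥ := by
    intro s'
    induction s' using Finset.induction_on with
    | empty => simp
    | insert a s' ha ih =>
      intro hsub
      rw [Finset.sum_insert ha, Ne, EReal.add_eq_bot_iff, not_or]
      exact ⟨hb a (hsub (Finset.mem_insert_self a s')),
        ih ((Finset.subset_insert a s').trans hsub)⟩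
  rw [← Finset.add_sum_erase s e hi, ht]
  exact EReal.top_add_of_ne_bot (hsum _ (Finset.erase_subset i s))

theorem coe_le_sum_eigenvalue {N : ℕ} {Ω : Set (EuclideanSpace ℝ (Fin N))} (hN : 1 ≤ N)
    (hfin : volume Ω ≠ ⊤) (k : ℕ) {R : ℝ} (hR : 0 < R) :
    ((2 * k * Real.log R - dConst N * volume.real Ω * R ^ N : ℝ) : EReal) ≤
      ∑ i ∈ Finset.Icc 1 k, eigenvalue Ω i := by
  have hre : ∑ i ∈ Finset.Icc 1 k, eigenvalue Ω i =
      ∑ i ∈ Finset.range k, eigenvalue Ω (i + 1) := by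
    rw [Finset.range_eq_Ico, Finset.sum_Ico_add' (fun i => eigenvalue Ω i) 0 k 1]
    rfl
  rw [hre]
  have hb : ∀ i, eigenvalue Ω (i + 1) ≠ ⊥ := eigenvalue_ne_bot hN hfin
  by_cases ht : ∃ i ∈ Finset.range k, eigenvalue Ω (i + 1) = ⊤
  · obtain ⟨i, hi, hit⟩ := ht
    rw [EReal_sum_eq_top _ (fun i _ => hb i) hi hit]
    exact le_top
  · push Not at ht
    have hr : ∀ i ∈ Finset.range k, eigenvalue Ω (i + 1) =
        ((eigenvalue Ω (i + 1)).toReal : EReal) := fun i hi =>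
      (EReal.coe_toReal (ht i hi) (hb i)).symm
    have hsum : ∑ i ∈ Finset.range k, eigenvalue Ω (i + 1) =
        ((∑ i ∈ Finset.range k, (eigenvalue Ω (i + 1)).toReal : ℝ) : EReal) := by
      rw [Finset.sum_congr rfl hr]
      exact (map_sum (⟨⟨Real.toEReal, EReal.coe_zero⟩, EReal.coe_add⟩ : ℝ →+ EReal) _ _).symm
    rw [hsum, EReal.coe_le_coe_iff]
    -- The infimum defining an eigenvalue is not known to be attained, so each is approximated
    -- within `ε/(k+1)`; `k + 1` keeps the denominator positive when `k = 0`.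
    refine le_of_forall_pos_le_add fun ε hε => ?_
    have hk : (0 : ℝ) < (k : ℝ) + 1 := by positivity
    have hex : ∀ i, ∃ t : ℝ, i < k → (t ≤ (eigenvalue Ω (i + 1)).toReal + ε / (k + 1) ∧
        HasEigenvaluesUpTo Ω (i + 1) t) := by
      intro i
      by_cases hi : i < k
      · obtain ⟨t, ht1, ht2⟩ := exists_lt_of_eigenvalue_lt (Ω := Ω) (k := i + 1)
          (r := (eigenvalue Ω (i + 1)).toReal + ε / (k + 1)) (by
            nth_rewrite 1 [hr i (Finset.mem_range.2 hi)]
            rw [EReal.coe_lt_coe_iff]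
            exact lt_add_of_pos_right _ (by positivity))
        exact ⟨t, fun _ => ⟨ht1.le, ht2⟩⟩
      · exact ⟨0, fun h => absurd h hi⟩
    choose t ht using hex
    refine (sum_ge_of_hasEigenvaluesUpTo hN hfin (fun i hi => (ht i hi).2) hR).trans ?_
    refine (Finset.sum_le_sum fun i hi => (ht i (Finset.mem_range.1 hi)).1).trans ?_
    rw [Finset.sum_add_distrib]
    simp only [Finset.sum_const, Finset.card_range, nsmul_eq_mul]
    gcongr
    rw [← mul_div_assoc, div_le_iff₀ hk]
    nlinarith

theorem dConst_pos {N : ℕ} (hN : 1 ≤ N) : 0 < dConst N := by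
  have hN' : (0 : ℝ) < N := by exact_mod_cast hN
  have := sphereArea_pos hN
  rw [dConst]
  positivity

/-- The bound with the optimal radius. -/
theorem coe_le_sum_eigenvalue_log {N : ℕ} {Ω : Set (EuclideanSpace ℝ (Fin N))} (hN : 1 ≤ N)
    (hfin : volume Ω ≠ ⊤) (hpos : 0 < volume.real Ω) {k : ℕ} (hk : 1 ≤ k) :
    ((2 * (k : ℝ) / N * Real.log (2 * k / (Real.exp 1 * N * dConst N * volume.real Ω)) : ℝ) :
      EReal) ≤ ∑ i ∈ Finset.Icc 1 k, eigenvalue Ω i := by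
  have hN' : (0 : ℝ) < N := by exact_mod_cast hN
  have hk' : (0 : ℝ) < k := by exact_mod_cast hk
  have hd := dConst_pos hN
  -- `R^N = y` is the critical point of `2k ln R - d_N |Ω| R^N`; the subtracted term then equals
  -- `2k/N`, which puts the factor `e` inside the logarithm.
  set y : ℝ := 2 * k / (N * dConst N * volume.real Ω) with hy
  have hy0 : 0 < y := by positivity
  have h := coe_le_sum_eigenvalue (Ω := Ω) hN hfin k (R := y ^ (1 / (N : ℝ))) (by positivity)
  refine le_trans (le_of_eq ?_) h
  have h1 : (y ^ (1 / (N : ℝ))) ^ N = y := by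
    rw [← Real.rpow_natCast, ← Real.rpow_mul hy0.le, one_div, inv_mul_cancel₀ hN'.ne',
      Real.rpow_one]
  have h2 : 2 * k / (Real.exp 1 * N * dConst N * volume.real Ω) = y / Real.exp 1 := by
    rw [hy]
    field_simp
  rw [h1, Real.log_rpow hy0, h2, Real.log_div hy0.ne' (Real.exp_pos 1).ne', Real.log_exp]
  have h3 : dConst N * volume.real Ω * y = 2 * k / N := by
    rw [hy]
    field_simp
  rw [h3]
  congr 1
  field_simp

end LogLaplacian

theorem mainTheorem2 (N : ℕ) (hN : 1 ≤ N) (Ω : Set (EuclideanSpace ℝ (Fin N)))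
    (hΩ_open : IsOpen Ω) (hΩ_conn : IsConnected Ω) (hΩ_bdd : Bornology.IsBounded Ω) :
    (∀ k : ℕ, 1 ≤ k →
      ((-(LogLaplacian.dConst N * volume.real Ω) : ℝ) : EReal) ≤
        ∑ i ∈ Finset.Icc 1 k, LogLaplacian.eigenvalue Ω i) ∧
    (∀ k : ℕ, 1 ≤ k →
      Real.exp 1 * N * LogLaplacian.dConst N / 2 * volume.real Ω < (k : ℝ) →
      0 < ∑ i ∈ Finset.Icc 1 k, LogLaplacian.eigenvalue Ω i) ∧
    (∀ k : ℕ, 1 ≤ k →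
      Real.exp (Real.exp 1 + 1) * N * LogLaplacian.dConst N / 2 * volume.real Ω ≤ (k : ℝ) →
      ((2 * (k : ℝ) / N *
          (Real.log k
            + Real.log (2 / (Real.exp 1 * N * LogLaplacian.dConst N * volume.real Ω))
            - Real.log (Real.log
                (2 * (k : ℝ) / (Real.exp 1 * N * LogLaplacian.dConst N * volume.real Ω)))) :
          ℝ) : EReal) ≤
        ∑ i ∈ Finset.Icc 1 k, LogLaplacian.eigenvalue Ω i) := by
  have hfin : volume Ω ≠ ⊤ := hΩ_bdd.measure_lt_top.ne
  have hpos : 0 < volume.real Ω :=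
    ENNReal.toReal_pos (hΩ_open.measure_pos volume hΩ_conn.nonempty).ne' hfin
  have hd := LogLaplacian.dConst_pos hN
  have hN' : (0 : ℝ) < N := by exact_mod_cast hN
  refine ⟨fun k _ => ?_, fun k hk hlt => ?_, fun k hk hle => ?_⟩
  · simpa using LogLaplacian.coe_le_sum_eigenvalue (Ω := Ω) hN hfin k one_pos
  · have hk' : (0 : ℝ) < k := by exact_mod_cast hk
    refine lt_of_lt_of_le ?_ (LogLaplacian.coe_le_sum_eigenvalue_log hN hfin hpos hk)
    have : 0 < Real.log (2 * k / (Real.exp 1 * N * LogLaplacian.dConst N * volume.real Ω)) := by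
      refine Real.log_pos ?_
      rw [one_lt_div (by positivity)]
      linarith
    exact_mod_cast (by positivity : (0 : ℝ) < 2 * (k : ℝ) / N *
      Real.log (2 * k / (Real.exp 1 * N * LogLaplacian.dConst N * volume.real Ω)))
  · have hk' : (0 : ℝ) < k := by exact_mod_cast hk
    refine le_trans ?_ (LogLaplacian.coe_le_sum_eigenvalue_log hN hfin hpos hk)
    rw [EReal.coe_le_coe_iff, ← Real.log_mul hk'.ne' (by positivity),
      show (k : ℝ) * (2 / (Real.exp 1 * N * LogLaplacian.dConst N * volume.real Ω)) =
        2 * k / (Real.exp 1 * N * LogLaplacian.dConst N * volume.real Ω) by ring]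
    -- The iterated logarithm is only subtracted, so it suffices that it be nonnegative: the
    -- hypothesis makes its inner argument at least `e^e ≥ e`.
    refine mul_le_mul_of_nonneg_left (sub_le_self _ (Real.log_nonneg ?_)) (by positivity)
    rw [Real.le_log_iff_exp_le (by positivity), le_div_iff₀ (by positivity)]
    have h1 : Real.exp 1 ≤ Real.exp (Real.exp 1) :=
      Real.exp_le_exp.2 (Real.one_le_exp zero_le_one)
    have h2 : 0 < Real.exp 1 * N * LogLaplacian.dConst N * volume.real Ω := by positivity
    rw [Real.exp_add] at hle
    nlinarith
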